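/- Let $\Gamma$ be a compact metric graph with finite vertex set $\mathcal V$ and finite edge set $\mathcal E$ (loops and parallel edges allowed), each edge $e$ being identified with an interval $[0,\ell_e]$, $\ell_e>0$. Let $\mathcal V_{\mathcal R}\subset\mathcal V$. For $t\ge 0$ let $H^{(t)}$ be the operator $-\frac{d^2}{dx^2}$ in $L^2(\Gamma)=\bigoplus_{e\in\mathcal E}L^2([0,\ell_e])$ whose domain consists of the functions $f$ that lie in $W^{2,2}$ on every edge, are continuous at every vertex, and satisfy $\sum_{e\in\mathcal E_v}f'|_e(v)=t\,f(v)$ for $v\in\mathcal V_{\mathcal R}$ and $\sum_{e\in\mathcal E_v}f'|_e(v)=0$ for $v\in\mathcal V\setminus\mathcal V_{\mathcal R}$; here $\mathcal E_v$ is the set of edges at $v$ (a loop being counted once for each of its two ends) and derivatives are taken in the direction from the vertex into the edge. Let $\lambda_1(t)\le\lambda_2(t)\le\dots$ be the eigenvalues of $H^{(t)}$, counted with multiplicity, and $d_n(t):=\lambda_n(t)-\lambda_n(0)$. A star decomposition of $\Gamma$ is a choice of a point $u_e$ on every edge $e$ (an end of $e$ is allowed). For a vertex $v$ and $e\in\mathcal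 E_v$ let $s_{v,u_e}\ge 0$ be the length of the part of $e$ between $v$ and $u_e$, and put $|\mathcal S_v|:=\sum_{e\in\mathcal E_v}s_{v,u_e}$ and $s_v:=\big(\sum_{e\in\mathcal E_v}s_{v,u_e}^{-1}\big)^{-1}$, with $s_v:=0$ if some $s_{v,u_e}$ is $0$. Fix $n\ge1$ and $\sigma>0$. For every $t\in[0,\sigma]$ choose a star decomposition (it may depend on $t$), with associated $|\mathcal S_v|$ and $s_v$, and a vertex $v_t\in\mathcal V_{\mathcal R}$ at which $$\max_{v\in\mathcal V_{\mathcal R}}\Big(|\mathcal S_v|+\frac{t^2s_v+t}{\lambda_n(t)}\Big)^{-1}$$ is attained (with $0^{-1}=\infty$). Let $\check s,\check S>0$ be constants such that $|\mathcal S_{v_t}|\ge\check S$ and $s_{v_t}\ge\check s$ for all $t\in[0,\sigma]$, the quantities being those of the star decomposition chosen for $t$. If $\lambda_n(0)>\frac1{4\check s\check S}$, then $$d_n(\sigma)<\left(\frac{\exp\left(2\alpha\arctan\left(\frac{\alpha}{2}\left[1+2\check s\sigma\right]\right)\right)}{\exp\left(2\alpha\arctan\left(\frac{\alpha}{2}\right)\right)}-1\right)\lambda_n(0),\qquad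 \alpha=\frac{2}{\sqrt{4\lambda_n(0)\check s\check S-1}}.$$ -/

import Mathlib

open MeasureTheory

noncomputable section

/-- A compact metric graph with vertex type `V` and (finite) edge type `E`. The edge `e` is the
interval `[0, len e]`; its endpoint at `0` is glued to the vertex `vert e false` and its endpoint
at `len e` to the vertex `vert e true`. Loops and parallel edges are allowed. -/
structure MetricGraph (V E : Type*) where
  vert : E → Bool → V
  len : E → ℝ
  len_pos : ∀ e, 0 < len e

namespace MetricGraph

variable {V E : Type*} (G : MetricGraph V E)

/-- The position, in the coordinate of `e`, of the endpoint `b` of `e`. -/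
def endCoord (e : E) (b : Bool) : ℝ := if b then G.len e else 0

/-- The half-edges `(e, b)` emanating from `v`, i.e. the edges at `v`, where a loop
is counted once for each of its two ends. -/
def halfEdges [Fintype E] [DecidableEq V] (v : V) : Finset (E × Bool) :=
  Finset.univ.filter fun h => G.vert h.1 h.2 = v

/-- The Hilbert space `L²(Γ) = ⨁ₑ L²([0, ℓₑ])`. -/
abbrev L2 [Fintype E] : Type _ :=
  PiLp 2 fun e : E => Lp ℂ 2 (volume.restrict (Set.Icc 0 (G.len e)))

/-- `f ∈ L²([0, ℓ])` belongs to the Sobolev space `W^{2,2}`, its second weak derivative is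
`g ∈ L²([0, ℓ])`, and `u`, `u'` are the continuous representatives on `[0, ℓ]` of `f` and of its
first derivative: `u` and `u'` are the absolutely continuous functions with derivatives `u'`
and `g` respectively. -/
structure IsSobolevRep (ℓ : ℝ) (f g : Lp ℂ 2 (volume.restrict (Set.Icc 0 ℓ)))
    (u u' : ℝ → ℂ) : Prop where
  rep : f =ᵐ[volume.restrict (Set.Icc 0 ℓ)] u
  integral_fst : ∀ x ∈ Set.Icc 0 ℓ, u x = u 0 + ∫ t in (0 : ℝ)..x, u' t
  integral_snd : ∀ x ∈ Set.Icc 0 ℓ, u' x = u' 0 + ∫ t in (0 : ℝ)..x, g t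

/-- The derivative at the endpoint `b` of the edge `e` in the direction pointing from the vertex
into the edge, where `u'` is the family of derivatives in the coordinates of the edges. -/
def outDeriv (u' : E → ℝ → ℂ) (e : E) (b : Bool) : ℂ :=
  if b then -u' e (G.len e) else u' e 0

/-- The vertex conditions: continuity at every vertex (with common value `φ v`), and
`∑ (outward derivatives at v) = σ φ(v)` at the vertices of `VR` (Robin condition),
`∑ (outward derivatives at v) = 0` at all others (Neumann-Kirchhoff condition). -/
structure VertexConditions [Fintype E] [DecidableEq V] (VR : Finset V) (σ : ℝ)
    (u u' : E → ℝ → ℂ) (φ : V → ℂ) : Prop where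
  cont : ∀ e b, u e (G.endCoord e b) = φ (G.vert e b)
  robin : ∀ v ∈ VR, ∑ h ∈ G.halfEdges v, G.outDeriv u' h.1 h.2 = σ * φ v
  kirchhoff : ∀ v ∉ VR, ∑ h ∈ G.halfEdges v, G.outDeriv u' h.1 h.2 = 0

/-- A star decomposition: a point `uₑ`, with coordinate `cut e`, on every edge `e`, possibly at an
end of `e`. -/
structure StarDecomposition where
  cut : E → ℝ
  cut_mem : ∀ e, cut e ∈ Set.Icc 0 (G.len e)

variable {G} in
/-- The length `s_{v,uₑ}` of the part of the edge `e` between its endpoint `b` (lying at `v`)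
and the point `uₑ`. -/
def StarDecomposition.armLength (D : G.StarDecomposition) (e : E) (b : Bool) : ℝ :=
  if b then G.len e - D.cut e else D.cut e

section aux

variable {ℓ : ℝ}

lemma edge_intervalIntegrable (hℓ : 0 ≤ ℓ) (g : Lp ℂ 2 (volume.restrict (Set.Icc 0 ℓ))) :
    IntervalIntegrable g volume 0 ℓ := by
  rw [intervalIntegrable_iff_integrableOn_Icc_of_le hℓ]
  exact (Lp.memLp g).integrable (by norm_num)

lemma IsSobolevRep.continuousOn_snd {f g : Lp ℂ 2 (volume.restrict (Set.Icc 0 ℓ))}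
    {u u' : ℝ → ℂ} (hℓ : 0 ≤ ℓ) (h : IsSobolevRep ℓ f g u u') :
    ContinuousOn u' (Set.Icc 0 ℓ) := by
  have := intervalIntegral.continuousOn_primitive_interval' (edge_intervalIntegrable hℓ g)
    (Set.left_mem_uIcc)
  rw [Set.uIcc_of_le hℓ] at this
  exact (continuousOn_const.add this).congr h.integral_snd

lemma IsSobolevRep.intervalIntegrable_snd {f g : Lp ℂ 2 (volume.restrict (Set.Icc 0 ℓ))}
    {u u' : ℝ → ℂ} (hℓ : 0 ≤ ℓ) (h : IsSobolevRep ℓ f g u u') :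
    IntervalIntegrable u' volume 0 ℓ := by
  apply ContinuousOn.intervalIntegrable
  rw [Set.uIcc_of_le hℓ]
  exact h.continuousOn_snd hℓ

lemma IsSobolevRep.continuousOn_fst {f g : Lp ℂ 2 (volume.restrict (Set.Icc 0 ℓ))}
    {u u' : ℝ → ℂ} (hℓ : 0 ≤ ℓ) (h : IsSobolevRep ℓ f g u u') :
    ContinuousOn u (Set.Icc 0 ℓ) := by
  have := intervalIntegral.continuousOn_primitive_interval' (h.intervalIntegrable_snd hℓ)
    (Set.left_mem_uIcc)
  rw [Set.uIcc_of_le hℓ] at this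
  exact (continuousOn_const.add this).congr h.integral_fst

lemma intervalIntegrable_sub {w : ℝ → ℂ} (hw : IntervalIntegrable w volume 0 ℓ) {x : ℝ}
    (hx : x ∈ Set.Icc 0 ℓ) : IntervalIntegrable w volume 0 x := by
  refine hw.mono_set ?_
  rw [Set.uIcc_of_le hx.1, Set.uIcc_of_le (hx.1.trans hx.2)]
  exact Set.Icc_subset_Icc_right hx.2

lemma integral_congr_edge {p q : ℝ → ℂ} (h : p =ᵐ[volume.restrict (Set.Icc 0 ℓ)] q) {x : ℝ}
    (hx : x ∈ Set.Icc 0 ℓ) : ∫ t in (0 : ℝ)..x, p t = ∫ t in (0 : ℝ)..x, q t := by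
  apply intervalIntegral.integral_congr_ae_restrict
  rw [Set.uIoc_of_le hx.1]
  exact ae_restrict_of_ae_restrict_of_subset
    (Set.Ioc_subset_Icc_self.trans (Set.Icc_subset_Icc_right hx.2)) h

lemma IsSobolevRep.add {f g f₂ g₂ : Lp ℂ 2 (volume.restrict (Set.Icc 0 ℓ))}
    {u u' u₂ u₂' : ℝ → ℂ} (hℓ : 0 ≤ ℓ) (h : IsSobolevRep ℓ f g u u')
    (h₂ : IsSobolevRep ℓ f₂ g₂ u₂ u₂') :
    IsSobolevRep ℓ (f + f₂) (g + g₂) (u + u₂) (u' + u₂') where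
  rep := (Lp.coeFn_add f f₂).trans (h.rep.add h₂.rep)
  integral_fst x hx := by
    simp only [Pi.add_apply]
    rw [intervalIntegral.integral_add (intervalIntegrable_sub (h.intervalIntegrable_snd hℓ) hx)
      (intervalIntegrable_sub (h₂.intervalIntegrable_snd hℓ) hx), h.integral_fst x hx,
      h₂.integral_fst x hx]
    ring
  integral_snd x hx := by
    rw [integral_congr_edge (Lp.coeFn_add g g₂) hx]
    simp only [Pi.add_apply]
    rw [intervalIntegral.integral_add (intervalIntegrable_sub (edge_intervalIntegrable hℓ g) hx)
      (intervalIntegrable_sub (edge_intervalIntegrable hℓ g₂) hx), h.integral_snd x hx,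
      h₂.integral_snd x hx]
    ring

lemma IsSobolevRep.smul {f g : Lp ℂ 2 (volume.restrict (Set.Icc 0 ℓ))}
    {u u' : ℝ → ℂ} (c : ℂ) (h : IsSobolevRep ℓ f g u u') :
    IsSobolevRep ℓ (c • f) (c • g) (c • u) (c • u') where
  rep := (Lp.coeFn_smul c f).trans (h.rep.const_smul c)
  integral_fst x hx := by
    simp only [Pi.smul_apply]
    rw [intervalIntegral.integral_smul, h.integral_fst x hx, smul_add]
  integral_snd x hx := by
    rw [integral_congr_edge (Lp.coeFn_smul c g) hx]
    simp only [Pi.smul_apply]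
    rw [intervalIntegral.integral_smul, h.integral_snd x hx, smul_add]

lemma isSobolevRep_zero : IsSobolevRep ℓ 0 0 0 0 where
  rep := Lp.coeFn_zero ℂ 2 _
  integral_fst x hx := by simp
  integral_snd x hx := by
    rw [integral_congr_edge (Lp.coeFn_zero ℂ 2 (volume.restrict (Set.Icc 0 ℓ))) hx]
    simp

lemma ae_zero_of_primitive_zero {w : ℝ → ℂ} (hℓ : 0 ≤ ℓ) (hw : IntervalIntegrable w volume 0 ℓ)
    (h : ∀ x ∈ Set.Icc 0 ℓ, ∫ t in (0 : ℝ)..x, w t = 0) :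
    w =ᵐ[volume.restrict (Set.Icc 0 ℓ)] 0 := by
  rw [← restrict_Ioo_eq_restrict_Icc]
  rw [Filter.EventuallyEq, ae_restrict_iff' measurableSet_Ioo]
  filter_upwards [hw.ae_hasDerivAt_integral] with x hx hxm
  rw [Set.uIcc_of_le hℓ] at hx
  have h1 := hx ⟨hxm.1.le, hxm.2.le⟩ 0 ⟨le_rfl, hℓ⟩
  have h2 : HasDerivAt (fun x => ∫ t in (0 : ℝ)..x, w t) 0 x := by
    refine (hasDerivAt_const x (0 : ℂ)).congr_of_eventuallyEq ?_
    filter_upwards [Ioo_mem_nhds hxm.1 hxm.2] with y hy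
    exact h y ⟨hy.1.le, hy.2.le⟩
  exact h1.unique h2

/-- The second weak derivative is determined by the function. -/
lemma IsSobolevRep.eq_zero {g : Lp ℂ 2 (volume.restrict (Set.Icc 0 ℓ))}
    {u u' : ℝ → ℂ} (hℓ : 0 < ℓ) (h : IsSobolevRep ℓ 0 g u u') : g = 0 := by
  have key : ∀ w : ℝ → ℂ, ContinuousOn w (Set.Icc 0 ℓ) →
      w =ᵐ[volume.restrict (Set.Icc 0 ℓ)] 0 → ∀ x ∈ Set.Icc 0 ℓ, w x = 0 := by
    intro w hw h0
    exact fun x hx => Measure.eqOn_Icc_of_ae_eq volume hℓ.ne h0 hw continuousOn_const hx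
  have hu := key u (h.continuousOn_fst hℓ.le) (h.rep.symm.trans (Lp.coeFn_zero ℂ 2 _))
  have hl : (0 : ℝ) ∈ Set.Icc 0 ℓ := ⟨le_rfl, hℓ.le⟩
  have hu' := key u' (h.continuousOn_snd hℓ.le) (ae_zero_of_primitive_zero hℓ.le
    (h.intervalIntegrable_snd hℓ.le) fun x hx => by
      have := h.integral_fst x hx
      rwa [hu x hx, hu 0 hl, zero_add, eq_comm] at this)
  have hg := ae_zero_of_primitive_zero hℓ.le (edge_intervalIntegrable hℓ.le g) fun x hx => by
      have := h.integral_snd x hx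
      rwa [hu' x hx, hu' 0 hl, zero_add, eq_comm] at this
  exact Lp.ext (hg.trans (Lp.coeFn_zero ℂ 2 _).symm)

end aux

variable [Fintype E] [DecidableEq V]

/-- The graph `{(f, -f'')}` of the operator `H^(σ)`: `f` runs through the functions that are
`W^{2,2}` on every edge and satisfy the vertex conditions. -/
def robinGraph (VR : Finset V) (σ : ℝ) : Submodule ℂ (G.L2 × G.L2) where
  carrier := {p | ∃ (u u' : E → ℝ → ℂ) (φ : V → ℂ),
    (∀ e, IsSobolevRep (G.len e) (p.1 e) (-p.2 e) (u e) (u' e)) ∧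
    G.VertexConditions VR σ u u' φ}
  zero_mem' := by
    refine ⟨0, 0, 0, fun e => ?_, ⟨?_, ?_, ?_⟩⟩
    · simpa using isSobolevRep_zero
    · intro e b; rfl
    · intro v _; simp [outDeriv]
    · intro v _; simp [outDeriv]
  add_mem' := by
    rintro p q ⟨u, u', φ, hs, hv⟩ ⟨w, w', ψ, hs₂, hv₂⟩
    refine ⟨u + w, u' + w', φ + ψ, fun e => ?_, ⟨?_, ?_, ?_⟩⟩
    · have := (hs e).add (G.len_pos e).le (hs₂ e)
      rw [← neg_add] at this
      exact this
    · intro e b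
      simp [hv.cont, hv₂.cont]
    · intro v h
      rw [Pi.add_apply, mul_add, ← hv.robin v h, ← hv₂.robin v h, ← Finset.sum_add_distrib]
      refine Finset.sum_congr rfl fun x _ => ?_
      unfold outDeriv; split_ifs <;> simp [add_comm]
    · intro v h
      rw [← add_zero (0 : ℂ)]
      nth_rewrite 1 [← hv.kirchhoff v h]
      rw [← hv₂.kirchhoff v h, ← Finset.sum_add_distrib]
      refine Finset.sum_congr rfl fun x _ => ?_
      unfold outDeriv; split_ifs <;> simp [add_comm]
  smul_mem' := by
    rintro c p ⟨u, u', φ, hs, hv⟩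
    have hout : ∀ e b, G.outDeriv (c • u') e b = c * G.outDeriv u' e b := by
      intro e b; unfold outDeriv; split_ifs <;> simp
    refine ⟨c • u, c • u', c • φ, fun e => ?_, ⟨?_, ?_, ?_⟩⟩
    · have := (hs e).smul c
      rw [smul_neg] at this
      exact this
    · intro e b
      simp [hv.cont]
    · intro v h
      simp only [hout, ← Finset.mul_sum, hv.robin v h, Pi.smul_apply, smul_eq_mul]
      ring
    · intro v h
      simp only [hout, ← Finset.mul_sum, hv.kirchhoff v h, mul_zero]

/-- `robinGraph` is the graph of a (single-valued) operator. -/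
lemma robinGraph_functional (VR : Finset V) (σ : ℝ) (p : G.L2 × G.L2)
    (hp : p ∈ G.robinGraph VR σ) (h0 : p.1 = 0) : p.2 = 0 := by
  obtain ⟨u, u', φ, hs, -⟩ := hp
  ext1 e
  have := hs e
  rw [h0] at this
  exact neg_eq_zero.1 (this.eq_zero (G.len_pos e))

/-- The operator `H^(σ) = -d²/dx²` in `L²(Γ)` with the Robin condition of parameter `σ` at the
vertices of `VR` and the Neumann-Kirchhoff condition at the others. -/
def robinLaplacian (VR : Finset V) (σ : ℝ) : G.L2 →ₗ.[ℂ] G.L2 :=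
  (G.robinGraph VR σ).toLinearPMap

lemma robinLaplacian_graph (VR : Finset V) (σ : ℝ) :
    (G.robinLaplacian VR σ).graph = G.robinGraph VR σ :=
  Submodule.toLinearPMap_graph_eq _ (G.robinGraph_functional VR σ)

/-- `f` lies in the domain of `H^(σ)` and `H^(σ) f = μ f`. -/
def InEigenspace (VR : Finset V) (σ : ℝ) (μ : ℝ) (f : G.L2) : Prop :=
  ∃ hf : f ∈ (G.robinLaplacian VR σ).domain, G.robinLaplacian VR σ ⟨f, hf⟩ = (μ : ℂ) • f

/-- The `n`-th eigenvalue `λₙ(σ)` of `H^(σ)`, `n = 1, 2, …`, in increasing order and counted with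
multiplicity: the least `x` such that there are `n` linearly independent eigenfunctions with
eigenvalues at most `x`. -/
def robinEigenvalue (VR : Finset V) (n : ℕ) (σ : ℝ) : ℝ :=
  sInf {x : ℝ | ∃ f : Fin n → G.L2, LinearIndependent ℂ f ∧
    ∀ i, ∃ μ ≤ x, G.InEigenspace VR σ μ (f i)}

/-- The Robin-Neumann gap `dₙ(σ) = λₙ(σ) - λₙ(0)`. -/
def robinNeumannGap (VR : Finset V) (n : ℕ) (σ : ℝ) : ℝ :=
  G.robinEigenvalue VR n σ - G.robinEigenvalue VR n 0

namespace StarDecomposition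

variable {G} (D : G.StarDecomposition)

/-- The total length `|S_v|` of the star around `v`. -/
def starLength (v : V) : ℝ := ∑ h ∈ G.halfEdges v, D.armLength h.1 h.2

open Classical in
/-- `s_v = 1 / ∑ᵤ s_{v,u}⁻¹`, and `s_v = 0` if some `s_{v,u} = 0`. -/
def starHarmonic (v : V) : ℝ :=
  if ∃ h ∈ G.halfEdges v, D.armLength h.1 h.2 = 0 then 0
  else 1 / ∑ h ∈ G.halfEdges v, (D.armLength h.1 h.2)⁻¹

/-- `(|S_v| + (t² s_v + t) / lam)⁻¹`, with values in `[0, ∞]` so that `0⁻¹ = ∞`. -/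
def sensitivityTerm (t lam : ℝ) (v : V) : ENNReal :=
  (ENNReal.ofReal (D.starLength v + (t ^ 2 * D.starHarmonic v + t) / lam))⁻¹

end StarDecomposition

end MetricGraph

end

/-! ### Spectral theory of the form `‖x‖² + t ‖T x‖²` relative to a compact map `J`. -/

namespace FormSpectrum

open scoped InnerProductSpace

variable {X H F : Type*} [NormedAddCommGroup X] [InnerProductSpace ℂ X]
  [NormedAddCommGroup H] [InnerProductSpace ℂ H] [NormedAddCommGroup F] [InnerProductSpace ℂ F]

/-! The eigenvalue `λ(t) = λₙ(t)` moves, where it is differentiable, with speed `∑_{v ∈ VR} |f(v)|²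
/ ‖f‖²` for a suitable eigenfunction `f`. The heart of the proof is a bound for this quotient over
the whole eigenspace. On an edge the amplitude `A = |f'|² + λ |f|²` of an eigenfunction is constant,
and integrating `⟨f, f'⟩' = A - 2λ|f|²` gives `2λ ∫ |f|² = A ℓ` plus boundary terms. Cut `ℓ` at the
point of the star decomposition, evaluate `A` at the end to which each piece belongs, and regroup by
vertices. The outward derivatives at `v ∈ VR` sum to `t f(v)`, so Cauchy–Schwarz bounds their
weighted square sum below by `s_v t² |f(v)|²`. This yields `∑_{v ∈ VR} (λ |S_v| + t² s_v + t)
|f(v)|² ≤ 2λ ‖f‖²` (`sum_vertexValue_le`). The choice of `v_t` makes every coefficient at least `λ S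
+ t² s + t`, and hence `λ' ≤ 2λ / (λ S + t² s + t)`.

Since `λ` is nondecreasing, `(log λ)' ≤ 2 / (λ(0) S + t² s + t)`. The assumption on `λ(0)` makes the
quadratic in the denominator free of real zeros, so its reciprocal integrates to an arctangent.
Strictness comes from replacing `λ(t)` by `λ(0)`, which loses something unless `λ` is constant; in
the constant case the bound is trivially strict (`sub_lt_of_dini`).

Eigenvalue crossings may destroy differentiability, so only the upper right Dini derivative is used.
It is controlled by min-max: the span of the eigenvectors up to `λ(t)` is a trial space at later
parameters, and the spectral gap below `λ(t)` absorbs the cross terms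
(`eventually_sInf_countSet_le`). For this the operator is replaced by its form on `H¹(Γ)`, with `J`
the compact inclusion into `L²(Γ)` and `T` the trace on `VR`. The `H¹` norm contains `‖f‖²`, so form
eigenvalues are `μ + 1` where operator eigenvalues are `μ`. -/

lemma inner_self_eq_ofReal (x : X) : ⟪x, x⟫_ℂ = ((‖x‖ ^ 2 : ℝ) : ℂ) := by
  rw [inner_self_eq_norm_sq_to_K]; simp

/-- The sesquilinear form `⟪x, y⟫ + t ⟪T x, T y⟫`. -/
noncomputable def form (T : X →L[ℂ] F) (t : ℝ) (x y : X) : ℂ := ⟪x, y⟫_ℂ + t * ⟪T x, T y⟫_ℂ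

/-- The quadratic form `‖x‖² + t ‖T x‖²`. -/
noncomputable def energy (T : X →L[ℂ] F) (t : ℝ) (x : X) : ℝ := ‖x‖ ^ 2 + t * ‖T x‖ ^ 2

lemma form_add_left (T : X →L[ℂ] F) (t : ℝ) (x y z : X) :
    form T t (x + y) z = form T t x z + form T t y z := by
  simp only [form, map_add, inner_add_left]; ring

lemma form_add_right (T : X →L[ℂ] F) (t : ℝ) (x y z : X) :
    form T t x (y + z) = form T t x y + form T t x z := by
  simp only [form, map_add, inner_add_right]; ring

lemma form_smul_left (T : X →L[ℂ] F) (t : ℝ) (c : ℂ) (x y : X) :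
    form T t (c • x) y = starRingEnd ℂ c * form T t x y := by
  simp only [form, map_smul, inner_smul_left]; ring

lemma form_zero_left (T : X →L[ℂ] F) (t : ℝ) (y : X) : form T t 0 y = 0 := by
  simp [form]

lemma form_conj_symm (T : X →L[ℂ] F) (t : ℝ) (x y : X) :
    starRingEnd ℂ (form T t y x) = form T t x y := by
  simp [form]

lemma form_self (T : X →L[ℂ] F) (t : ℝ) (x : X) : form T t x x = (energy T t x : ℂ) := by
  simp [form, energy, inner_self_eq_norm_sq_to_K]

lemma energy_mono (T : X →L[ℂ] F) {t t' : ℝ} (h : t ≤ t') (x : X) :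
    energy T t x ≤ energy T t' x := by
  unfold energy; gcongr

lemma sq_norm_le_energy (T : X →L[ℂ] F) {t : ℝ} (ht : 0 ≤ t) (x : X) :
    ‖x‖ ^ 2 ≤ energy T t x := by
  unfold energy
  have : 0 ≤ t * ‖T x‖ ^ 2 := by positivity
  linarith

/-- Weak solutions of the eigenvalue equation `form(x, y) = ν ⟪J x, J y⟫`. -/
def weakEigenspace (J : X →L[ℂ] H) (T : X →L[ℂ] F) (t ν : ℝ) : Submodule ℂ X where
  carrier := {x | ∀ y, form T t x y = ν * ⟪J x, J y⟫_ℂ}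
  zero_mem' y := by simp [form_zero_left]
  add_mem' {a b} ha hb y := by
    rw [form_add_left, ha y, hb y, map_add, inner_add_left]; ring
  smul_mem' c x hx y := by
    rw [form_smul_left, hx y, map_smul, inner_smul_left]; ring

variable {J : X →L[ℂ] H} {T : X →L[ℂ] F} {t : ℝ}

lemma energy_of_mem {ν : ℝ} {x : X} (hx : x ∈ weakEigenspace J T t ν) :
    energy T t x = ν * ‖J x‖ ^ 2 := by
  have := hx x
  rw [form_self, inner_self_eq_ofReal] at this
  exact_mod_cast this

lemma orthogonal_of_ne {ν ν' : ℝ} (h : ν ≠ ν') {x y : X} (hx : x ∈ weakEigenspace J T t ν)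
    (hy : y ∈ weakEigenspace J T t ν') : ⟪J x, J y⟫_ℂ = 0 := by
  have h1 := hx y
  rw [← form_conj_symm, hy x, map_mul, Complex.conj_ofReal, inner_conj_symm] at h1
  have h2 : ((ν : ℂ) - ν') * ⟪J x, J y⟫_ℂ = 0 := by rw [sub_mul, h1]; simp
  rcases mul_eq_zero.1 h2 with h3 | h3
  · exact absurd (by exact_mod_cast sub_eq_zero.1 h3) h
  · exact h3

lemma eigenvalue_pos (ht : 0 ≤ t) {ν : ℝ} {x : X} (hx : x ∈ weakEigenspace J T t ν)
    (h0 : x ≠ 0) : 0 < ν := by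
  have h1 := energy_of_mem hx
  have h2 := sq_norm_le_energy T ht x
  have h3 : 0 < ‖x‖ ^ 2 := by positivity
  by_contra h
  nlinarith [sq_nonneg ‖J x‖]

lemma map_ne_zero_of_mem (ht : 0 ≤ t) {ν : ℝ} {x : X} (hx : x ∈ weakEigenspace J T t ν)
    (h0 : x ≠ 0) : J x ≠ 0 := by
  intro h
  have h1 := energy_of_mem hx
  have h2 := sq_norm_le_energy T ht x
  have h3 : 0 < ‖x‖ ^ 2 := by positivity
  rw [h] at h1
  simp at h1
  linarith

/-- The span of the weak eigenvectors with eigenvalue at most `N`. -/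
def lowSpace (J : X →L[ℂ] H) (T : X →L[ℂ] F) (t N : ℝ) : Submodule ℂ X :=
  ⨆ ν : Set.Iic N, weakEigenspace J T t ν

lemma weakEigenspace_le_lowSpace {ν N : ℝ} (h : ν ≤ N) :
    weakEigenspace J T t ν ≤ lowSpace J T t N :=
  le_iSup (fun ν : Set.Iic N => weakEigenspace J T t ν) ⟨ν, h⟩

/-- Eigenvectors for different eigenvalues are orthogonal both for the form and for `⟪J ·, J ·⟫`, so
on a sum of eigenvectors both quadratic forms are diagonal and can be compared term by term. -/
lemma energy_le_of_mem_lowSpace {N : ℝ} {z : X} (hz : z ∈ lowSpace J T t N) :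
    energy T t z ≤ N * ‖J z‖ ^ 2 := by
  classical
  obtain ⟨f, hf, rfl⟩ := (Submodule.mem_iSup_iff_exists_finsupp _ _).1 hz
  have hJ : ⟪J (f.sum fun _ x => x), J (f.sum fun _ x => x)⟫_ℂ
      = ((∑ i ∈ f.support, ‖J (f i)‖ ^ 2 : ℝ) : ℂ) := by
    simp only [Finsupp.sum, map_sum, sum_inner, inner_sum]
    push_cast
    refine Finset.sum_congr rfl fun i hi => ?_
    rw [Finset.sum_eq_single_of_mem i hi]
    · simp [inner_self_eq_norm_sq_to_K]
    · intro j _ hj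
      exact orthogonal_of_ne (fun h => hj (Subtype.ext h)) (hf j) (hf i)
  have hE : form T t (f.sum fun _ x => x) (f.sum fun _ x => x)
      = ((∑ i ∈ f.support, (i : ℝ) * ‖J (f i)‖ ^ 2 : ℝ) : ℂ) := by
    have hleft : ∀ (s : Finset (Set.Iic N)) (y : X),
        form T t (∑ i ∈ s, f i) y = ∑ i ∈ s, form T t (f i) y := by
      intro s y
      induction s using Finset.induction_on with
      | empty => simp [form_zero_left]
      | insert a s ha ih => rw [Finset.sum_insert ha, Finset.sum_insert ha, form_add_left, ih]
    simp only [Finsupp.sum]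
    rw [hleft]
    push_cast
    refine Finset.sum_congr rfl fun i hi => ?_
    rw [hf i, map_sum, inner_sum, Finset.sum_eq_single_of_mem i hi]
    · simp [inner_self_eq_norm_sq_to_K]
    · intro j _ hj
      exact orthogonal_of_ne (fun h => hj (Subtype.ext h.symm)) (hf i) (hf j)
  rw [form_self] at hE
  rw [inner_self_eq_ofReal] at hJ
  have hE' : energy T t (f.sum fun _ x => x) = ∑ i ∈ f.support, (i : ℝ) * ‖J (f i)‖ ^ 2 := by
    exact_mod_cast hE
  have hJ' : ‖J (f.sum fun _ x => x)‖ ^ 2 = ∑ i ∈ f.support, ‖J (f i)‖ ^ 2 := by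
    exact_mod_cast hJ
  rw [hE', hJ', Finset.mul_sum]
  exact Finset.sum_le_sum fun i _ => mul_le_mul_of_nonneg_right i.2 (sq_nonneg _)

/-- On the low space `‖z‖² ≤ N ‖J z‖²`, so there the compact map `J` is bounded below, which forces
local compactness. The closure is taken because completeness is needed for `J` to be a closed
embedding. -/
lemma finiteDimensional_lowSpace [CompleteSpace X] (hJ : IsCompactOperator J) (ht : 0 ≤ t)
    (N : ℝ) : FiniteDimensional ℂ (lowSpace J T t N) := by
  set Z := (lowSpace J T t N).topologicalClosure with hZ
  have hle : ∀ z ∈ Z, ‖z‖ ^ 2 ≤ N * ‖J z‖ ^ 2 := by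
    have hcl : IsClosed {z : X | ‖z‖ ^ 2 ≤ N * ‖J z‖ ^ 2} :=
      isClosed_le (by fun_prop) (by fun_prop)
    intro z hz
    have hsub : (lowSpace J T t N : Set X) ⊆ {z : X | ‖z‖ ^ 2 ≤ N * ‖J z‖ ^ 2} :=
      fun z hz => (sq_norm_le_energy T ht z).trans (energy_le_of_mem_lowSpace hz)
    exact closure_minimal hsub hcl hz
  have hZc : IsClosed (Z : Set X) := Submodule.isClosed_topologicalClosure _
  have : CompleteSpace Z := hZc.completeSpace_coe
  have hanti : AntilipschitzWith (Real.toNNReal √(max N 0)) (J.comp Z.subtypeL) := by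
    refine AddMonoidHomClass.antilipschitz_of_bound _ fun z => ?_
    rw [Real.coe_toNNReal _ (Real.sqrt_nonneg _)]
    refine abs_le_of_sq_le_sq' ?_ (by positivity) |>.2
    rw [mul_pow, Real.sq_sqrt (le_max_right _ _)]
    refine (hle z z.2).trans ?_
    exact mul_le_mul_of_nonneg_right (le_max_left _ _) (sq_nonneg _)
  have hemb : Topology.IsClosedEmbedding (J.comp Z.subtypeL) :=
    hanti.isClosedEmbedding (J.comp Z.subtypeL).uniformContinuous
  obtain ⟨K, hK, hK0⟩ := hJ
  have hfin : FiniteDimensional ℂ Z := by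
    apply FiniteDimensional.of_isCompactOperator_id
    refine ⟨_, hemb.isCompact_preimage hK, ?_⟩
    have := (Z.subtypeL.continuous.tendsto 0)
    rw [map_zero] at this
    exact this hK0
  exact Submodule.finiteDimensional_of_le (S₂ := Z) (Submodule.le_topologicalClosure _)

/-- Choosing one eigenvector for each eigenvalue up to `Λ + 1` gives an independent family in a
finite-dimensional space. Only finitely many such eigenvalues exist, so they cannot accumulate at
`Λ`. -/
lemma exists_gap [CompleteSpace X] (hJ : IsCompactOperator J) (ht : 0 ≤ t) (Λ : ℝ) :
    ∃ γ > 0, ∀ ν, ν ≠ Λ → |ν - Λ| < γ → weakEigenspace J T t ν = ⊥ := by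
  set B : Set ℝ := {ν | ν ≤ Λ + 1 ∧ ν ≠ Λ ∧ weakEigenspace J T t ν ≠ ⊥} with hB
  have hfin : B.Finite := by
    have := finiteDimensional_lowSpace (T := T) hJ ht (Λ + 1)
    have hx : ∀ ν : B, ∃ x ∈ weakEigenspace J T t ν, x ≠ 0 := fun ν =>
      Submodule.exists_mem_ne_zero_of_ne_bot ν.2.2.2
    choose x hx h0 using hx
    have hli : LinearIndependent ℂ fun ν : B => J (x ν) :=
      linearIndependent_of_ne_zero_of_inner_eq_zero
        (fun ν => map_ne_zero_of_mem ht (hx ν) (h0 ν))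
        fun i j hij => orthogonal_of_ne (fun h => hij (Subtype.ext h)) (hx i) (hx j)
    have hli' : LinearIndependent ℂ x := LinearIndependent.of_comp J.toLinearMap hli
    have hli'' : LinearIndependent ℂ
        (fun ν : B => (⟨x ν, weakEigenspace_le_lowSpace ν.2.1 (hx ν)⟩ :
          lowSpace J T t (Λ + 1))) :=
      LinearIndependent.of_comp (lowSpace J T t (Λ + 1)).subtype hli'
    exact Set.finite_coe_iff.1 hli''.finite
  have hopen : Bᶜ ∈ nhds Λ := hfin.isClosed.isOpen_compl.mem_nhds (fun h => h.2.1 rfl)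
  obtain ⟨ε, hε, hball⟩ := Metric.mem_nhds_iff.1 hopen
  refine ⟨min ε 1, lt_min hε one_pos, fun ν hne hlt => ?_⟩
  by_contra hbot
  refine hball (a := ν) ?_ ⟨?_, hne, hbot⟩
  · rw [Metric.mem_ball, Real.dist_eq]; exact hlt.trans_le (min_le_left _ _)
  · have := (abs_lt.1 (hlt.trans_le (min_le_right _ _))).2; linarith

/-- The `x` such that there are `n` independent weak eigenvectors with eigenvalues at most `x`. -/
def countSet (J : X →L[ℂ] H) (T : X →L[ℂ] F) (n : ℕ) (t : ℝ) : Set ℝ :=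
  {x | ∃ f : Fin n → X, LinearIndependent ℂ f ∧ ∀ i, ∃ ν ≤ x, f i ∈ weakEigenspace J T t ν}

lemma countSet_pos {n : ℕ} (hn : 1 ≤ n) (ht : 0 ≤ t) {x : ℝ} (hx : x ∈ countSet J T n t) :
    0 < x := by
  obtain ⟨f, hf, h⟩ := hx
  obtain ⟨ν, hν, hm⟩ := h ⟨0, hn⟩
  exact (eigenvalue_pos ht hm (hf.ne_zero _)).trans_le hν

/-- For `n = 0` the set is all of `ℝ`; with `1 ≤ n` some eigenvalue lies below each member, and
eigenvalues are positive. -/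
lemma bddBelow_countSet {n : ℕ} (hn : 1 ≤ n) (ht : 0 ≤ t) : BddBelow (countSet J T n t) :=
  ⟨0, fun _ hx => (countSet_pos hn ht hx).le⟩

/-- The infimum is attained because there is no eigenvalue just above it: a family that is
admissible for a slightly larger bound already has all its eigenvalues at most the infimum. -/
lemma sInf_mem_countSet [CompleteSpace X] (hJ : IsCompactOperator J) {n : ℕ}
    (ht : 0 ≤ t) (hne : (countSet J T n t).Nonempty) :
    sInf (countSet J T n t) ∈ countSet J T n t := by
  obtain ⟨γ, hγ, hgap⟩ := exists_gap (T := T) hJ ht (sInf (countSet J T n t))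
  obtain ⟨x, ⟨f, hf, h⟩, hlt⟩ := exists_lt_of_csInf_lt hne (lt_add_of_pos_right _ hγ)
  refine ⟨f, hf, fun i => ?_⟩
  obtain ⟨ν, hν, hm⟩ := h i
  refine ⟨ν, ?_, hm⟩
  by_contra! hlt'
  have := hgap ν hlt'.ne' (by rw [abs_of_pos (by linarith)]; linarith)
  rw [this, Submodule.mem_bot] at hm
  exact hf.ne_zero i hm

end FormSpectrum

/-! ### Existence of eigenvectors and the min-max principle. -/

namespace FormSpectrum

open scoped InnerProductSpace

/-- A nonzero operator `B† B` with `B` compact has its norm as an eigenvalue. -/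
lemma exists_eigenvector_norm {K H : Type*} [NormedAddCommGroup K] [InnerProductSpace ℂ K]
    [CompleteSpace K] [NormedAddCommGroup H] [InnerProductSpace ℂ H] [CompleteSpace H]
    (B : K →L[ℂ] H) (hB : IsCompactOperator B) {ν : ℝ} (hν : 0 < ν) {w : K} (hw : B w ≠ 0)
    (hle : ‖w‖ ^ 2 ≤ ν * ‖B w‖ ^ 2) :
    ∃ (θ : ℝ) (k : K), 0 < θ ∧ θ ≤ ν ∧ k ≠ 0 ∧ ∀ y, ⟪k, y⟫_ℂ = θ * ⟪B k, B y⟫_ℂ := by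
  set A : K →L[ℂ] K := (ContinuousLinearMap.adjoint B).comp B with hA
  have hAin : ∀ x y, ⟪A x, y⟫_ℂ = ⟪B x, B y⟫_ℂ := fun x y => by
    simp [hA, ContinuousLinearMap.adjoint_inner_left]
  have hAc : IsCompactOperator A := by
    have : IsCompactOperator (ContinuousLinearMap.adjoint B ∘ B) := hB.clm_comp _
    exact this
  have hw0 : w ≠ 0 := fun h => hw (by rw [h, map_zero])
  have : Nontrivial K := ⟨w, 0, hw0⟩
  have hAsymm : A.IsSymmetric := fun x y => by
    change ⟪A x, y⟫_ℂ = ⟪x, A y⟫_ℂ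
    rw [hAin, ← inner_conj_symm x, hAin, inner_conj_symm]
  have hBw : 0 < ‖B w‖ ^ 2 := by positivity
  have hnorm : 1 ≤ ν * ‖A‖ := by
    have h1 : ‖B w‖ ^ 2 ≤ ‖A‖ * ‖w‖ ^ 2 := by
      have h2 : ‖⟪A w, w⟫_ℂ‖ ≤ ‖A‖ * ‖w‖ * ‖w‖ :=
        (norm_inner_le_norm _ _).trans (by gcongr; exact A.le_opNorm w)
      rw [hAin, inner_self_eq_ofReal, Complex.norm_real, Real.norm_of_nonneg hBw.le] at h2
      linarith
    have h3 : ‖B w‖ ^ 2 ≤ (ν * ‖A‖) * ‖B w‖ ^ 2 := by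
      calc ‖B w‖ ^ 2 ≤ ‖A‖ * ‖w‖ ^ 2 := h1
        _ ≤ ‖A‖ * (ν * ‖B w‖ ^ 2) := by gcongr
        _ = _ := by ring
    by_contra! h
    nlinarith
  have hApos : 0 < ‖A‖ := by
    by_contra! h
    nlinarith [norm_nonneg A]
  -- `A` is positive, so its norm is the supremum of its Rayleigh quotient without absolute values.
  -- If `‖A‖` were in the resolvent set, the quotient would stay below `‖A‖ - ε`.
  have hspec : algebraMap ℝ ℂ ‖A‖ ∈ spectrum ℂ A := by
    by_contra hns
    obtain ⟨ε, hε, hray⟩ := A.rayleighQuotient_le_of_norm_mem_resolventSet (not_not.1 hns)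
    have hn := A.norm_eq_iSup_rayleighQuotient hAsymm
    have : ‖A‖ ≤ ‖A‖ - ε := by
      conv_lhs => rw [hn]
      refine ciSup_le fun x => ?_
      rw [abs_of_nonneg]
      · exact hray x
      · rw [ContinuousLinearMap.rayleighQuotient, ContinuousLinearMap.reApplyInnerSelf_apply,
          hAin, inner_self_eq_ofReal]
        simp only [RCLike.re_to_complex, Complex.ofReal_re]
        positivity
    linarith
  have hne : algebraMap ℝ ℂ ‖A‖ ≠ 0 := by simpa using hApos.ne'
  obtain ⟨k, hk⟩ := ((hAc.hasEigenvalue_iff_mem_spectrum hne).2 hspec).exists_hasEigenvector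
  -- The largest eigenvalue of `B† B` corresponds to the smallest `θ`, and the trial vector `w` gave
  -- `1 ≤ ν ‖A‖`.
  refine ⟨‖A‖⁻¹, k, inv_pos.2 hApos, ?_, hk.2, fun y => ?_⟩
  · rw [inv_le_comm₀ hApos hν, inv_le_iff_one_le_mul₀ hν]; linarith
  · have h1 : A k = (‖A‖ : ℂ) • k := hk.apply_eq_smul
    rw [← hAin, h1, inner_smul_left, Complex.conj_ofReal, Complex.ofReal_inv, ← mul_assoc,
      inv_mul_cancel₀ (by exact_mod_cast hApos.ne'), one_mul]

variable {X H F : Type*} [NormedAddCommGroup X] [InnerProductSpace ℂ X]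
  [NormedAddCommGroup H] [InnerProductSpace ℂ H] [NormedAddCommGroup F] [InnerProductSpace ℂ F]

/-- The map `x ↦ (x, √t T x)`, under which the form is the pullback of the inner product. -/
noncomputable def formGraph (T : X →L[ℂ] F) (t : ℝ) : X →L[ℂ] WithLp 2 (X × F) :=
  (WithLp.prodContinuousLinearEquiv 2 ℂ X F).symm.toContinuousLinearMap.comp
    ((ContinuousLinearMap.id ℂ X).prod (((√t : ℝ) : ℂ) • T))

lemma formGraph_fst (T : X →L[ℂ] F) (t : ℝ) (x : X) : (formGraph T t x).fst = x := rfl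

lemma inner_formGraph (T : X →L[ℂ] F) {t : ℝ} (ht : 0 ≤ t) (x y : X) :
    ⟪formGraph T t x, formGraph T t y⟫_ℂ = form T t x y := by
  have h2 : (formGraph T t x).snd = ((√t : ℝ) : ℂ) • T x := rfl
  have h3 : (formGraph T t y).snd = ((√t : ℝ) : ℂ) • T y := rfl
  rw [WithLp.prod_inner_apply]
  change ⟪(formGraph T t x).fst, (formGraph T t y).fst⟫_ℂ
    + ⟪(formGraph T t x).snd, (formGraph T t y).snd⟫_ℂ = _
  rw [h2, h3, formGraph_fst, formGraph_fst, inner_smul_left, inner_smul_right,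
    Complex.conj_ofReal, ← mul_assoc, ← Complex.ofReal_mul, Real.mul_self_sqrt ht, form]

lemma norm_sq_formGraph (T : X →L[ℂ] F) {t : ℝ} (ht : 0 ≤ t) (x : X) :
    ‖formGraph T t x‖ ^ 2 = energy T t x := by
  have := inner_formGraph T ht x x
  rw [form_self, inner_self_eq_ofReal] at this
  exact_mod_cast this

/-- A graph is the set where the second coordinate agrees with a continuous function of the first.
Closedness makes the range a Hilbert space whose inner product is the form, so that `X` need not be
given a new norm. -/
lemma isClosed_range_formGraph [CompleteSpace X] (T : X →L[ℂ] F) (t : ℝ) :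
    IsClosed (LinearMap.range (formGraph T t).toLinearMap : Set (WithLp 2 (X × F))) := by
  have : (LinearMap.range (formGraph T t).toLinearMap : Set (WithLp 2 (X × F))) =
      {p | formGraph T t p.fst = p} := by
    ext p
    constructor
    · rintro ⟨x, rfl⟩; rfl
    · intro hp; exact ⟨p.fst, hp⟩
  rw [this]
  have hc : Continuous fun p : WithLp 2 (X × F) => p.fst :=
    continuous_fst.comp (WithLp.prodContinuousLinearEquiv 2 ℂ X F).continuous
  exact isClosed_eq ((formGraph T t).continuous.comp hc) continuous_id

variable {J : X →L[ℂ] H} {T : X →L[ℂ] F} {t : ℝ}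

/-- Variational existence of an eigenvector orthogonal to a space of eigenvectors. -/
lemma exists_weakEigenvector_orthogonal [CompleteSpace X] [CompleteSpace H] [CompleteSpace F]
    (hJ : IsCompactOperator J) (ht : 0 ≤ t) {N : ℝ} {w : X} (hw : J w ≠ 0)
    (hperp : ∀ z ∈ lowSpace J T t N, ⟪J z, J w⟫_ℂ = 0) {ν : ℝ} (hν : 0 < ν)
    (hle : energy T t w ≤ ν * ‖J w‖ ^ 2) :
    ∃ θ ≤ ν, ∃ x ∈ weakEigenspace J T t θ, x ≠ 0 ∧
      ∀ z ∈ lowSpace J T t N, ⟪J z, J x⟫_ℂ = 0 := by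
  set Z := lowSpace J T t N with hZ
  have hfd : FiniteDimensional ℂ Z := finiteDimensional_lowSpace hJ ht N
  set S := formGraph T t with hS
  -- the forms vanish together on `Z × X`
  have hiff : ∀ x, (∀ z ∈ Z, ⟪J z, J x⟫_ℂ = 0) → ∀ z ∈ Z, form T t z x = 0 := by
    intro x hx z hz
    have hle : Z ≤ (⊤ : Submodule ℂ X) := le_top
    refine Submodule.iSup_induction' (p := fun ν : Set.Iic N => weakEigenspace J T t ν)
      (motive := fun z _ => form T t z x = 0) ?_ ?_ ?_ hz
    · intro ν z hz'
      rw [hz' x, hx z (weakEigenspace_le_lowSpace ν.2 hz'), mul_zero]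
    · exact form_zero_left T t x
    · intro a b _ _ ha hb
      rw [form_add_left, ha, hb, add_zero]
  set SZ := Z.map S.toLinearMap with hSZ
  have hfd' : FiniteDimensional ℂ SZ := inferInstance
  -- `K` is the form-orthogonal complement of `Z`, realised as a complete subspace of `X × F`;
  -- maximising `‖J ·‖` relative to the form on it produces the new eigenvector.
  set K : Submodule ℂ (WithLp 2 (X × F)) := LinearMap.range S.toLinearMap ⊓ SZᗮ with hK
  have hKc : IsClosed (K : Set (WithLp 2 (X × F))) :=
    (isClosed_range_formGraph T t).inter (Submodule.isClosed_orthogonal _)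
  have : CompleteSpace K := hKc.completeSpace_coe
  let P : WithLp 2 (X × F) →L[ℂ] X :=
    (ContinuousLinearMap.fst ℂ X F).comp
      (WithLp.prodContinuousLinearEquiv 2 ℂ X F).toContinuousLinearMap
  have hP : ∀ x, P (S x) = x := fun x => rfl
  have hmem : ∀ x, (∀ z ∈ Z, form T t z x = 0) → S x ∈ K := by
    intro x hx
    refine ⟨⟨x, rfl⟩, ?_⟩
    rw [SetLike.mem_coe, Submodule.mem_orthogonal]
    rintro _ ⟨z, hz, rfl⟩
    change ⟪S z, S x⟫_ℂ = 0
    rw [inner_formGraph T ht, hx z hz]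
  let B : K →L[ℂ] H := (J.comp P).comp K.subtypeL
  have hBc : IsCompactOperator B := (hJ.comp_clm P).comp_clm K.subtypeL
  have hwK := hmem w (hiff w hperp)
  obtain ⟨θ, k, hθ, hθν, hk0, hk⟩ := exists_eigenvector_norm B hBc hν (w := ⟨S w, hwK⟩) hw
    (by
      change ‖S w‖ ^ 2 ≤ ν * ‖J w‖ ^ 2
      rw [norm_sq_formGraph T ht]; exact hle)
  obtain ⟨⟨x, hx⟩, hkorth⟩ := k.2
  have hx : S x = k := hx
  have hBk : B k = J x := by change J (P k) = J x; rw [← hx, hP]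
  have hform : ∀ z ∈ Z, form T t z x = 0 := by
    intro z hz
    rw [SetLike.mem_coe, Submodule.mem_orthogonal] at hkorth
    rw [← inner_formGraph T ht]
    have := hkorth (S z) ⟨z, hz, rfl⟩
    rwa [← hx] at this
  -- The converse passage, from form-orthogonality to `J`-orthogonality, divides by the eigenvalue
  -- and so uses its positivity.
  have hJx : ∀ z ∈ Z, ⟪J z, J x⟫_ℂ = 0 := by
    intro z hz
    refine Submodule.iSup_induction' (p := fun ν : Set.Iic N => weakEigenspace J T t ν)
      (motive := fun z _ => ⟪J z, J x⟫_ℂ = 0) ?_ ?_ ?_ hz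
    · intro ν z hz'
      by_cases hz0 : z = 0
      · simp [hz0]
      have h1 := hz' x
      rw [hform z (weakEigenspace_le_lowSpace ν.2 hz')] at h1
      have h2 : ((ν : ℝ) : ℂ) ≠ 0 := by exact_mod_cast (eigenvalue_pos ht hz' hz0).ne'
      exact (mul_eq_zero.1 h1.symm).resolve_left h2
    · simp
    · intro a b _ _ ha hb
      rw [map_add, inner_add_left, ha, hb, add_zero]
  refine ⟨θ, hθν, x, ?_, ?_, hJx⟩
  · intro y
    -- The equation for `x` is known only against test vectors in `K`. A general `y` differs from
    -- such a vector by some `z ∈ Z`, and both sides of the equation vanish on `z`.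
    obtain ⟨z, hz, hzeq⟩ : ∃ z ∈ Z, S z = SZ.starProjection (S y) := by
      obtain ⟨z, hz, h⟩ := SZ.starProjection_apply_mem (S y)
      exact ⟨z, hz, h⟩
    have hy : S (y - z) ∈ K := by
      refine ⟨⟨y - z, rfl⟩, ?_⟩
      rw [map_sub, hzeq]
      exact SZ.sub_starProjection_mem_orthogonal (S y)
    have h1 := hk ⟨S (y - z), hy⟩
    have h2 : B ⟨S (y - z), hy⟩ = J (y - z) := rfl
    have h3 : ⟪k, (⟨S (y - z), hy⟩ : K)⟫_ℂ = form T t x (y - z) := by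
      rw [← inner_formGraph T ht, ← hS, hx]; rfl
    rw [h3, h2, hBk] at h1
    have h4 : form T t x z = 0 := by
      rw [← form_conj_symm, hform z hz, map_zero]
    have h5 : ⟪J x, J z⟫_ℂ = 0 := by
      rw [← inner_conj_symm, hJx z hz, map_zero]
    have h6 : y = (y - z) + z := by abel
    have h7 : form T t x y = form T t x (y - z) := by
      conv_lhs => rw [h6, form_add_right, h4, add_zero]
    have h8 : ⟪J x, J y⟫_ℂ = ⟪J x, J (y - z)⟫_ℂ := by
      conv_lhs => rw [h6, map_add, inner_add_right, h5, add_zero]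
    rw [h7, h8, h1]
  · rintro rfl
    exact hk0 (Subtype.ext (by rw [← hx]; simp))

/-- Membership in `countSet` asks for independent eigenvectors, not merely for independent elements
of their span, so the vectors must be picked from the spanning set itself. -/
lemma exists_linearIndependent_of_le_finrank {s : Set X} {n : ℕ}
    [FiniteDimensional ℂ (Submodule.span ℂ s)] (h : n ≤ Module.finrank ℂ (Submodule.span ℂ s)) :
    ∃ f : Fin n → X, LinearIndependent ℂ f ∧ ∀ i, f i ∈ s := by
  obtain ⟨b, hbs, hspan, hli⟩ := exists_linearIndependent ℂ s
  have hb : Module.finrank ℂ (Submodule.span ℂ b) = Nat.card b := by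
    have := Module.finrank_eq_nat_card_basis (Module.Basis.span hli)
    rwa [Subtype.range_coe] at this
  have hfin : Finite b := by
    have hli' : LinearIndependent ℂ fun i : b =>
        (⟨i, Submodule.subset_span (hbs i.2)⟩ : Submodule.span ℂ s) :=
      LinearIndependent.of_comp (Submodule.span ℂ s).subtype hli
    exact hli'.finite
  have := Fintype.ofFinite b
  rw [hspan, Nat.card_eq_fintype_card] at hb
  obtain ⟨e⟩ := Function.Embedding.nonempty_of_card_le (α := Fin n) (β := b)
    (by rw [Fintype.card_fin, ← hb]; exact h)
  exact ⟨fun i => e i, hli.comp e e.injective, fun i => hbs (e i).2⟩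

/-- **Min-max principle**: a trial space of dimension `n` bounds the `n`-th eigenvalue. -/
lemma mem_countSet_of_trial [CompleteSpace X] [CompleteSpace H] [CompleteSpace F]
    (hJ : IsCompactOperator J) (ht : 0 ≤ t) {n : ℕ} {ν : ℝ} (hν : 0 < ν) {f : Fin n → X}
    (hf : LinearIndependent ℂ f)
    (hle : ∀ z ∈ Submodule.span ℂ (Set.range f), energy T t z ≤ ν * ‖J z‖ ^ 2) :
    ν ∈ countSet J T n t := by
  set Z := lowSpace J T t ν with hZ
  have hfd : FiniteDimensional ℂ Z := finiteDimensional_lowSpace hJ ht ν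
  have hspan : Z = Submodule.span ℂ (⋃ θ : Set.Iic ν, (weakEigenspace J T t θ : Set X)) := by
    rw [hZ, lowSpace, Submodule.iSup_eq_span]
  by_cases hn : n ≤ Module.finrank ℂ Z
  · have hfd' := hfd
    rw [hspan] at hn hfd'
    obtain ⟨g, hg, hgm⟩ := exists_linearIndependent_of_le_finrank hn
    refine ⟨g, hg, fun i => ?_⟩
    obtain ⟨θ, hθ⟩ := Set.mem_iUnion.1 (hgm i)
    exact ⟨θ, θ.2, hθ⟩
  -- If `Z` has dimension below `n`, some nonzero trial vector `w` is `J`-orthogonal to `Z`. It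
  -- yields an eigenvector with eigenvalue at most `ν` that is `J`-orthogonal to `Z`; but such an
  -- eigenvector lies in `Z`, so it is `J`-orthogonal to itself.
  · exfalso
    set W := Submodule.span ℂ (Set.range f)
    set JZ := Z.map J.toLinearMap
    have hfd2 : FiniteDimensional ℂ JZ := inferInstance
    have hfdW : FiniteDimensional ℂ W := FiniteDimensional.span_of_finite ℂ (Set.finite_range f)
    have hWn : Module.finrank ℂ W = n := by
      rw [finrank_span_eq_card hf, Fintype.card_fin]
    let φ : W →ₗ[ℂ] JZ :=
      JZ.orthogonalProjectionOnto.toLinearMap ∘ₗ J.toLinearMap ∘ₗ W.subtype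
    have hker : LinearMap.ker φ ≠ ⊥ := by
      apply LinearMap.ker_ne_bot_of_finrank_lt
      have : Module.finrank ℂ JZ ≤ Module.finrank ℂ Z :=
        Submodule.finrank_map_le J.toLinearMap Z
      omega
    obtain ⟨w, hw, hw0⟩ := Submodule.exists_mem_ne_zero_of_ne_bot hker
    have hφ : JZ.orthogonalProjectionOnto (J w) = 0 := hw
    have hperp : ∀ z ∈ Z, ⟪J z, J w⟫_ℂ = 0 := by
      rw [Submodule.orthogonalProjectionOnto_eq_zero_iff, Submodule.mem_orthogonal] at hφ
      exact fun z hz => hφ _ ⟨z, hz, rfl⟩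
    have hw0' : (w : X) ≠ 0 := fun h => hw0 (Subtype.ext h)
    have hJw : J w ≠ 0 := by
      intro h
      have h1 := hle w w.2
      have h2 := sq_norm_le_energy T ht (w : X)
      have h3 : 0 < ‖(w : X)‖ ^ 2 := by positivity
      rw [h] at h1; simp at h1; linarith
    obtain ⟨θ, hθ, x, hx, hx0, hxp⟩ :=
      exists_weakEigenvector_orthogonal hJ ht hJw hperp hν (hle w w.2)
    have := hxp x (weakEigenspace_le_lowSpace hθ hx)
    exact map_ne_zero_of_mem ht hx hx0 (inner_self_eq_zero.1 this)

end FormSpectrum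

/-! ### Monotonicity, Lipschitz continuity and one-sided growth in the parameter `t`. -/

namespace FormSpectrum

open scoped InnerProductSpace

variable {X H F : Type*} [NormedAddCommGroup X] [InnerProductSpace ℂ X]
  [NormedAddCommGroup H] [InnerProductSpace ℂ H] [NormedAddCommGroup F] [InnerProductSpace ℂ F]

variable {J : X →L[ℂ] H} {T : X →L[ℂ] F} {t t' : ℝ} {n : ℕ}

lemma sq_norm_apply_le_energy (T : X →L[ℂ] F) (ht : 0 ≤ t) (x : X) :
    ‖T x‖ ^ 2 ≤ ‖T‖ ^ 2 * energy T t x := by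
  calc ‖T x‖ ^ 2 ≤ (‖T‖ * ‖x‖) ^ 2 := by gcongr; exact T.le_opNorm x
    _ = ‖T‖ ^ 2 * ‖x‖ ^ 2 := by ring
    _ ≤ _ := by gcongr; exact sq_norm_le_energy T ht x

lemma energy_le_mul_energy (T : X →L[ℂ] F) (ht : 0 ≤ t) (htt' : t ≤ t') (x : X) :
    energy T t' x ≤ (1 + (t' - t) * ‖T‖ ^ 2) * energy T t x := by
  have h1 : energy T t' x = energy T t x + (t' - t) * ‖T x‖ ^ 2 := by unfold energy; ring
  have h2 := mul_le_mul_of_nonneg_left (sq_norm_apply_le_energy T ht x) (sub_nonneg.2 htt')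
  linarith

variable [CompleteSpace X] [CompleteSpace H] [CompleteSpace F]

lemma mem_countSet_of_energy_le (hJ : IsCompactOperator J) (ht' : 0 ≤ t')
    {x : ℝ} (hx : x ∈ countSet J T n t) {ν : ℝ} (hν : 0 < ν)
    (h : ∀ z ∈ lowSpace J T t x, energy T t' z ≤ ν * ‖J z‖ ^ 2) :
    ν ∈ countSet J T n t' := by
  obtain ⟨f, hf, hm⟩ := hx
  refine mem_countSet_of_trial hJ ht' hν hf fun z hz => h z ?_
  refine Submodule.span_le.2 ?_ hz
  rintro _ ⟨i, rfl⟩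
  obtain ⟨θ, hθ, hmem⟩ := hm i
  exact weakEigenspace_le_lowSpace hθ hmem

lemma mul_mem_countSet (hJ : IsCompactOperator J) (hn : 1 ≤ n) (ht : 0 ≤ t) (htt' : t ≤ t')
    {x : ℝ} (hx : x ∈ countSet J T n t) :
    (1 + (t' - t) * ‖T‖ ^ 2) * x ∈ countSet J T n t' := by
  have h0 : 0 < 1 + (t' - t) * ‖T‖ ^ 2 := by
    have : 0 ≤ (t' - t) * ‖T‖ ^ 2 := mul_nonneg (sub_nonneg.2 htt') (sq_nonneg _)
    linarith
  refine mem_countSet_of_energy_le hJ (ht.trans htt') hx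
    (mul_pos h0 (countSet_pos hn ht hx)) fun z hz => ?_
  rw [mul_assoc]
  exact (energy_le_mul_energy T ht htt' z).trans
    (mul_le_mul_of_nonneg_left (energy_le_of_mem_lowSpace hz) h0.le)

lemma countSet_antitone (hJ : IsCompactOperator J) (hn : 1 ≤ n) (ht : 0 ≤ t) (htt' : t ≤ t') :
    countSet J T n t' ⊆ countSet J T n t := fun _ hx =>
  mem_countSet_of_energy_le hJ ht hx (countSet_pos hn (ht.trans htt') hx) fun z hz =>
    (energy_mono T htt' z).trans (energy_le_of_mem_lowSpace hz)

lemma countSet_nonempty (hJ : IsCompactOperator J) (hn : 1 ≤ n)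
    (hne : (countSet J T n 0).Nonempty) (ht : 0 ≤ t) : (countSet J T n t).Nonempty :=
  hne.elim fun _ hx => ⟨_, mul_mem_countSet hJ hn le_rfl ht hx⟩

lemma sInf_countSet_mono (hJ : IsCompactOperator J) (hn : 1 ≤ n)
    (hne : (countSet J T n 0).Nonempty) (ht : 0 ≤ t) (htt' : t ≤ t') :
    sInf (countSet J T n t) ≤ sInf (countSet J T n t') :=
  csInf_le_csInf (bddBelow_countSet hn ht) (countSet_nonempty hJ hn hne (ht.trans htt'))
    (countSet_antitone hJ hn ht htt')

lemma sInf_countSet_le_mul (hJ : IsCompactOperator J) (hn : 1 ≤ n)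
    (hne : (countSet J T n 0).Nonempty) (ht : 0 ≤ t) (htt' : t ≤ t') :
    sInf (countSet J T n t') ≤ (1 + (t' - t) * ‖T‖ ^ 2) * sInf (countSet J T n t) :=
  csInf_le (bddBelow_countSet hn (ht.trans htt')) <|
    mul_mem_countSet hJ hn ht htt' (sInf_mem_countSet hJ ht (countSet_nonempty hJ hn hne ht))

/-- Increasing `t` by `h` multiplies the energy by at most `1 + h ‖T‖²`, hence also the eigenvalue.
As the eigenvalue is at most its value `M` at `σ`, it is Lipschitz with constant `‖T‖² M`. -/
lemma continuousOn_sInf_countSet (hJ : IsCompactOperator J) (hn : 1 ≤ n)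
    (hne : (countSet J T n 0).Nonempty) (σ : ℝ) :
    ContinuousOn (fun t => sInf (countSet J T n t)) (Set.Icc 0 σ) := by
  rcases le_or_gt 0 σ with hσ | hσ
  swap
  · rw [Set.Icc_eq_empty (not_le.2 hσ)]; exact continuousOn_empty _
  set M := sInf (countSet J T n σ)
  have hM : 0 < M := countSet_pos hn hσ
    (sInf_mem_countSet hJ hσ (countSet_nonempty hJ hn hne hσ))
  have key : ∀ x ∈ Set.Icc 0 σ, ∀ y ∈ Set.Icc 0 σ, x ≤ y →
      |sInf (countSet J T n x) - sInf (countSet J T n y)| ≤ (‖T‖ ^ 2 * M) * |x - y| := by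
    intro x hx y hy hxy
    have h1 := sInf_countSet_mono hJ hn hne hx.1 hxy
    have h2 := sInf_countSet_le_mul hJ hn hne hx.1 hxy
    have h3 := sInf_countSet_mono hJ hn hne hx.1 hx.2
    rw [abs_of_nonpos (by linarith), abs_of_nonpos (by linarith)]
    have h4 : (y - x) * ‖T‖ ^ 2 * sInf (countSet J T n x) ≤ (y - x) * ‖T‖ ^ 2 * M :=
      mul_le_mul_of_nonneg_left h3 (mul_nonneg (by linarith) (sq_nonneg _))
    nlinarith
  have hlip : LipschitzOnWith (Real.toNNReal (‖T‖ ^ 2 * M))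
      (fun t => sInf (countSet J T n t)) (Set.Icc 0 σ) := by
    refine LipschitzOnWith.of_dist_le_mul fun x hx y hy => ?_
    rw [Real.coe_toNNReal _ (by positivity), Real.dist_eq, Real.dist_eq]
    rcases le_total x y with h | h
    · exact key x hx y hy h
    · rw [abs_sub_comm, abs_sub_comm x]; exact key y hy x hx h
  exact hlip.continuousOn

/-- The right upper Dini derivative of the `n`-th eigenvalue is bounded by any bound for
`‖T x‖² / ‖J x‖²` on the eigenspace. -/
lemma eventually_sInf_countSet_le (hJ : IsCompactOperator J) (hn : 1 ≤ n)
    (hne : (countSet J T n 0).Nonempty) (ht : 0 ≤ t) {r r' : ℝ} (hr : 0 ≤ r) (hrr' : r < r')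
    (hbound : ∀ x ∈ weakEigenspace J T t (sInf (countSet J T n t)),
      ‖T x‖ ^ 2 ≤ r * ‖J x‖ ^ 2) :
    ∀ᶠ y in nhdsWithin t (Set.Ioi t),
      sInf (countSet J T n y) ≤ sInf (countSet J T n t) + (y - t) * r' := by
  set Λ := sInf (countSet J T n t) with hΛ
  have hΛm : Λ ∈ countSet J T n t := sInf_mem_countSet hJ ht (countSet_nonempty hJ hn hne ht)
  have hΛ0 : 0 < Λ := countSet_pos hn ht hΛm
  obtain ⟨γ, hγ, hgap⟩ := exists_gap (T := T) hJ ht Λ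
  -- `δ` is the weight in Young's inequality for the cross term: small enough that `(1 + δ) r ≤ r'`.
  set δ := (r' - r) / (r + 1) with hδ
  have hδ0 : 0 < δ := div_pos (by linarith) (by linarith)
  have hδr : (1 + δ) * r ≤ r' := by
    have : δ * (r + 1) = r' - r := by rw [hδ]; field_simp
    nlinarith
  -- `(y - t) C ‖J l‖²` bounds the perturbation attributed to the part `l` of the trial vector below
  -- the gap. Restricting to `y - t < γ / (C + 1)` keeps it within the gap `γ`.
  set C := (1 + δ⁻¹) * (‖T‖ ^ 2 * Λ) with hC
  have hC0 : 0 ≤ C := by positivity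
  filter_upwards [Ioo_mem_nhdsGT (show t < t + γ / (C + 1) by
    have : 0 < γ / (C + 1) := by positivity
    linarith)] with y hy
  have hh : 0 < y - t := by linarith [hy.1]
  have hhC : (y - t) * C ≤ γ := by
    have h1 : y - t ≤ γ / (C + 1) := by linarith [hy.2]
    rw [le_div_iff₀ (by linarith)] at h1
    nlinarith
  have hy0 : 0 ≤ y := by linarith
  refine csInf_le (bddBelow_countSet hn hy0) ?_
  refine mem_countSet_of_energy_le hJ hy0 hΛm (by nlinarith) fun z hz => ?_
  -- No eigenvalue lies strictly between `Λ - γ` and `Λ`. Hence a trial vector is `u + l` with `u`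
  -- in the eigenspace, where `hbound` applies, and `l` having energy at most `(Λ - γ) ‖J l‖²`.
  have hle : lowSpace J T t Λ ≤ weakEigenspace J T t Λ ⊔ lowSpace J T t (Λ - γ) := by
    refine iSup_le fun ν => ?_
    rcases eq_or_ne (ν : ℝ) Λ with h | h
    · rw [h]; exact le_sup_left
    · by_cases h2 : |(ν : ℝ) - Λ| < γ
      · rw [hgap ν h h2]; exact bot_le
      · refine (weakEigenspace_le_lowSpace ?_).trans le_sup_right
        have h3 : (ν : ℝ) ≤ Λ := ν.2
        rw [abs_of_nonpos (by linarith)] at h2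
        linarith
  obtain ⟨u, hu, l, hl, rfl⟩ := Submodule.mem_sup.1 (hle hz)
  have horth : ⟪J u, J l⟫_ℂ = 0 := by
    refine Submodule.iSup_induction' (p := fun ν : Set.Iic (Λ - γ) => weakEigenspace J T t ν)
      (motive := fun l _ => ⟪J u, J l⟫_ℂ = 0) ?_ ?_ ?_ hl
    · intro ν x hx
      have : (ν : ℝ) ≤ Λ - γ := ν.2
      exact orthogonal_of_ne (by linarith) hu hx
    · simp
    · intro a b _ _ ha hb
      rw [map_add, inner_add_right, ha, hb, add_zero]
  have hJn : ‖J (u + l)‖ ^ 2 = ‖J u‖ ^ 2 + ‖J l‖ ^ 2 := by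
    rw [map_add, sq, norm_add_sq_eq_norm_sq_add_norm_sq_of_inner_eq_zero _ _ horth]; ring
  have hEn : energy T t (u + l) = energy T t u + energy T t l := by
    have h1 : form T t u l = 0 := by rw [hu l, horth, mul_zero]
    have h2 : form T t l u = 0 := by rw [← form_conj_symm, h1, map_zero]
    have h3 : form T t (u + l) (u + l) = form T t u u + form T t l l := by
      rw [form_add_left, form_add_right, form_add_right, h1, h2]; ring
    simp only [form_self] at h3
    exact_mod_cast h3
  have hEy : energy T y (u + l) = energy T t (u + l) + (y - t) * ‖T (u + l)‖ ^ 2 := by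
    unfold energy; ring
  have hT : ‖T (u + l)‖ ^ 2 ≤ (1 + δ) * ‖T u‖ ^ 2 + (1 + δ⁻¹) * ‖T l‖ ^ 2 := by
    have h1 : ‖T (u + l)‖ ^ 2 ≤ (‖T u‖ + ‖T l‖) ^ 2 := by
      rw [map_add]; gcongr; exact norm_add_le _ _
    have h2 : 0 ≤ δ * (‖T u‖ - δ⁻¹ * ‖T l‖) ^ 2 := by positivity
    have h3 : δ * (‖T u‖ - δ⁻¹ * ‖T l‖) ^ 2
        = δ * ‖T u‖ ^ 2 - 2 * ‖T u‖ * ‖T l‖ + δ⁻¹ * ‖T l‖ ^ 2 := by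
      field_simp; ring
    linarith [add_sq ‖T u‖ ‖T l‖]
  have hl1 := energy_le_of_mem_lowSpace hl
  have hTl : ‖T l‖ ^ 2 ≤ ‖T‖ ^ 2 * Λ * ‖J l‖ ^ 2 := by
    refine (sq_norm_apply_le_energy T ht l).trans ?_
    rw [mul_assoc]
    refine mul_le_mul_of_nonneg_left (hl1.trans ?_) (sq_nonneg _)
    exact mul_le_mul_of_nonneg_right (by linarith) (sq_nonneg _)
  have hTu : (1 + δ) * ‖T u‖ ^ 2 ≤ r' * ‖J u‖ ^ 2 := by
    calc (1 + δ) * ‖T u‖ ^ 2 ≤ (1 + δ) * (r * ‖J u‖ ^ 2) := by gcongr; exact hbound u hu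
      _ = ((1 + δ) * r) * ‖J u‖ ^ 2 := by ring
      _ ≤ _ := by gcongr
  have hTl' : (y - t) * ((1 + δ⁻¹) * ‖T l‖ ^ 2) ≤ γ * ‖J l‖ ^ 2 := by
    calc (y - t) * ((1 + δ⁻¹) * ‖T l‖ ^ 2)
        ≤ (y - t) * ((1 + δ⁻¹) * (‖T‖ ^ 2 * Λ * ‖J l‖ ^ 2)) := by gcongr
      _ = ((y - t) * C) * ‖J l‖ ^ 2 := by rw [hC]; ring
      _ ≤ _ := by gcongr
  have hr'l : 0 ≤ (y - t) * (r' * ‖J l‖ ^ 2) :=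
    mul_nonneg hh.le (mul_nonneg (by linarith) (sq_nonneg _))
  rw [hEy, hEn, hJn, energy_of_mem hu]
  have h5 := mul_le_mul_of_nonneg_left hT hh.le
  have h6 := mul_le_mul_of_nonneg_left hTu hh.le
  nlinarith

end FormSpectrum

/-! ### Integration of the differential inequality. -/

namespace DiniComparison

/-- By `log z ≤ z - 1`, a difference quotient of `log f` is at most that of `f` divided by `f x`, so
the Dini bound `f' ≤ B' f` becomes `(log f)' ≤ B'`. -/
lemma log_le_of_dini {f : ℝ → ℝ} {a b : ℝ} (hf : ContinuousOn f (Set.Icc a b))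
    (hpos : ∀ x ∈ Set.Icc a b, 0 < f x) {B B' ρ : ℝ → ℝ} (ha : Real.log (f a) ≤ B a)
    (hB : ∀ x, HasDerivAt B (B' x) x) (hρ : ∀ x ∈ Set.Ico a b, ρ x ≤ B' x * f x)
    (hdini : ∀ x ∈ Set.Ico a b, ∀ r, ρ x < r →
      ∀ᶠ y in nhdsWithin x (Set.Ioi x), f y ≤ f x + (y - x) * r) (hab : a ≤ b) :
    Real.log (f b) ≤ B b := by
  refine image_le_of_liminf_slope_right_le_deriv_boundary
    (f := fun x => Real.log (f x)) (a := a) (b := b) (B := B) (B' := B')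
    (hf.log fun x hx => (hpos x hx).ne') ha
    (fun x _ => (hB x).continuousAt.continuousWithinAt) (fun x _ => (hB x).hasDerivWithinAt)
    ?_ (Set.right_mem_Icc.2 hab)
  intro x hx r hr
  have hfx := hpos x ⟨hx.1, hx.2.le⟩
  obtain ⟨r₁, hr₁, hr₁'⟩ := exists_between hr
  refine Filter.Eventually.frequently ?_
  filter_upwards [hdini x hx (r₁ * f x) ((hρ x hx).trans_lt (by gcongr)),
    Ioo_mem_nhdsGT hx.2] with y hy hyI
  have hfy := hpos y ⟨hx.1.trans hyI.1.le, hyI.2.le⟩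
  have hxy : 0 < y - x := sub_pos.2 hyI.1
  rw [slope_def_field, div_lt_iff₀ hxy, ← Real.log_div hfy.ne' hfx.ne']
  have h1 := Real.log_le_sub_one_of_pos (div_pos hfy hfx)
  have h2 : f y / f x - 1 ≤ r₁ * (y - x) := by
    rw [sub_le_iff_le_add, div_le_iff₀ hfx]; nlinarith
  nlinarith

/-- Complete the square: `4 s (c + t² s + t) = (4 c s - 1) + (2 s t + 1)²`. The hypothesis `1 < 4 c
s` is what makes the primitive an arctangent; it is used with `c = f 0 * S`. -/
lemma hasDerivAt_arctan_primitive {c s : ℝ} (hs : 0 < s) (hc : 1 < 4 * c * s) (α : ℝ)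
    (hα : α = 2 / √(4 * c * s - 1)) (t : ℝ) :
    HasDerivAt (fun t => 2 * α * Real.arctan (α / 2 * (1 + 2 * s * t)))
      (2 / (c + t ^ 2 * s + t)) t := by
  set q := √(4 * c * s - 1) with hq
  have hq0 : 0 < q := Real.sqrt_pos.2 (by linarith)
  have hq2 : q ^ 2 = 4 * c * s - 1 := Real.sq_sqrt (by linarith)
  have h1 : HasDerivAt (fun t => α / 2 * (1 + 2 * s * t)) (α / 2 * (2 * s)) t := by
    have := (((hasDerivAt_id t).const_mul (2 * s)).const_add 1).const_mul (α / 2)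
    simpa using this
  have h2 := (h1.arctan).const_mul (2 * α)
  convert! h2 using 1
  have hden : 0 < c + t ^ 2 * s + t := by
    have : 4 * s * (c + t ^ 2 * s + t) = q ^ 2 + (2 * s * t + 1) ^ 2 := by rw [hq2]; ring
    have h3 : 0 < q ^ 2 + (2 * s * t + 1) ^ 2 := by positivity
    by_contra! h
    nlinarith
  rw [hα]
  have h4 : 0 < 1 + (2 / q / 2 * (1 + 2 * s * t)) ^ 2 := by positivity
  have h5 : q ^ 2 * (1 + (2 / q / 2 * (1 + 2 * s * t)) ^ 2) = 4 * s * (c + t ^ 2 * s + t) := by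
    have : 4 * s * (c + t ^ 2 * s + t) = q ^ 2 + (2 * s * t + 1) ^ 2 := by rw [hq2]; ring
    rw [this]; field_simp; ring
  have h6 : 1 + (2 / q / 2 * (1 + 2 * s * t)) ^ 2 = 4 * s * (c + t ^ 2 * s + t) / q ^ 2 := by
    rw [← h5]; field_simp
  rw [h6]
  field_simp
  ring

/-- Strict Grönwall-type comparison for `f' ≤ 2 f / (f S + t² s + t)`. -/
lemma sub_lt_of_dini {f : ℝ → ℝ} {σ s S : ℝ} (hσ : 0 < σ) (hs : 0 < s) (hS : 0 < S)
    (hf : ContinuousOn f (Set.Icc 0 σ)) (hmono : MonotoneOn f (Set.Icc 0 σ))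
    (h0 : 1 / (4 * s * S) < f 0) {α : ℝ} (hα : α = 2 / √(4 * f 0 * s * S - 1))
    (hdini : ∀ t ∈ Set.Ico 0 σ, ∀ r, 2 * f t / (f t * S + t ^ 2 * s + t) < r →
      ∀ᶠ y in nhdsWithin t (Set.Ioi t), f y ≤ f t + (y - t) * r) :
    f σ - f 0 < (Real.exp (2 * α * Real.arctan (α / 2 * (1 + 2 * s * σ))) /
      Real.exp (2 * α * Real.arctan (α / 2)) - 1) * f 0 := by
  have hf0 : 0 < f 0 := lt_trans (by positivity) h0
  have hge : ∀ a ∈ Set.Icc 0 σ, ∀ x ∈ Set.Icc 0 σ, a ≤ x → f a ≤ f x :=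
    fun a ha x hx hax => hmono ha hx hax
  have h0mem : (0 : ℝ) ∈ Set.Icc 0 σ := ⟨le_rfl, hσ.le⟩
  have hσmem : σ ∈ Set.Icc 0 σ := ⟨hσ.le, le_rfl⟩
  have hpos : ∀ x ∈ Set.Icc 0 σ, 0 < f x := fun x hx => hf0.trans_le (hge 0 h0mem x hx hx.1)
  have hc : 1 < 4 * (f 0 * S) * s := by
    rw [div_lt_iff₀ (by positivity)] at h0; linarith
  set G : ℝ → ℝ := fun t => 2 * α * Real.arctan (α / 2 * (1 + 2 * s * t)) with hG
  have hGd : ∀ t, HasDerivAt G (2 / (f 0 * S + t ^ 2 * s + t)) t :=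
    hasDerivAt_arctan_primitive hs hc α (by rw [hα]; ring_nf)
  have hα0 : 0 < α := by
    rw [hα]
    have : 0 < 4 * f 0 * s * S - 1 := by linarith
    positivity
  have hG0 : G 0 = 2 * α * Real.arctan (α / 2) := by simp [hG]
  rw [← Real.exp_sub, ← hG0]
  change f σ - f 0 < (Real.exp (G σ - G 0) - 1) * f 0
  suffices hlog : Real.log (f σ) < Real.log (f 0) + (G σ - G 0) by
    have : f σ < f 0 * Real.exp (G σ - G 0) := by
      rw [← Real.exp_log (hpos σ hσmem)]
      calc Real.exp (Real.log (f σ)) < Real.exp (Real.log (f 0) + (G σ - G 0)) :=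
            Real.exp_lt_exp.2 hlog
        _ = _ := by rw [Real.exp_add, Real.exp_log hf0]
    linarith
  -- If `f` does not grow at all, strictness comes from the strict growth of `G`.
  rcases (hge 0 h0mem σ hσmem hσ.le).eq_or_lt with heq | hlt
  · rw [← heq]
    have : G 0 < G σ := by
      simp only [hG]
      have : α / 2 * (1 + 2 * s * 0) < α / 2 * (1 + 2 * s * σ) := by gcongr
      have := Real.arctan_strictMono this
      gcongr
    linarith
  · -- `f` exceeds some `m > f 0` near `σ`, which makes the differential inequality strict there
    obtain ⟨m, hm0, hmσ⟩ := exists_between hlt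
    obtain ⟨τ, hτ, hτm⟩ : ∃ τ ∈ Set.Ico 0 σ, ∀ x ∈ Set.Icc τ σ, m ≤ f x := by
      obtain ⟨τ, hτ, hfτ⟩ := intermediate_value_Icc hσ.le hf ⟨hm0.le, hmσ.le⟩
      refine ⟨τ, ⟨hτ.1, hτ.2.lt_of_ne ?_⟩, fun x hx => ?_⟩
      · rintro rfl; linarith
      · rw [← hfτ]; exact hge τ hτ x ⟨hτ.1.trans hx.1, hx.2⟩ hx.1
    -- On `[0, τ]` the non-strict estimate suffices: `f 0 ≤ f x` allows `f 0` in place of `f x` in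
    -- the denominator.
    have hfirst : Real.log (f τ) ≤ Real.log (f 0) + (G τ - G 0) := by
      refine log_le_of_dini (f := f) (a := 0) (b := τ)
        (B := fun t => Real.log (f 0) + (G t - G 0))
        (hf.mono (Set.Icc_subset_Icc_right hτ.2.le))
        (fun x hx => hpos x ⟨hx.1, hx.2.trans hτ.2.le⟩) (by simp)
        (fun x => ((hGd x).sub_const _).const_add _) ?_
        (fun x hx => hdini x ⟨hx.1, hx.2.trans hτ.2⟩) hτ.1
      intro x hx
      have hx0 : 0 ≤ x := hx.1
      have h1 := hge 0 h0mem x ⟨hx.1, hx.2.le.trans hτ.2.le⟩ hx.1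
      have h2 := hf0.trans_le h1
      rw [div_mul_eq_mul_div]
      gcongr
    set D := m * S + σ ^ 2 * s + σ with hD
    have hm : 0 < m := hf0.trans hm0
    have hDpos : 0 < D := by positivity
    -- A uniform lower bound on `[τ, σ)` for the difference of the rates `2 / (f 0 S + p)` and `2 /
    -- (m S + p)`, where `p = x² s + x`; `D` bounds both denominators. This surplus makes the final
    -- inequality strict.
    set κ := 2 * (m - f 0) * S / D ^ 2 with hκ
    have hκ0 : 0 < κ := by
      have : 0 < m - f 0 := by linarith
      positivity
    have hsecond : Real.log (f σ) ≤ Real.log (f τ) + (G σ - G τ - κ * (σ - τ)) := by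
      refine log_le_of_dini (f := f) (a := τ) (b := σ)
        (B := fun t => Real.log (f τ) + (G t - G τ - κ * (t - τ)))
        (B' := fun t => 2 / (f 0 * S + t ^ 2 * s + t) - κ)
        (hf.mono (Set.Icc_subset_Icc_left hτ.1))
        (fun x hx => hpos x ⟨hτ.1.trans hx.1, hx.2⟩) (by simp)
        (fun x => ?_) ?_ (fun x hx => hdini x ⟨hτ.1.trans hx.1, hx.2⟩) hτ.2.le
      · have h1 : HasDerivAt (fun t => κ * (t - τ)) κ x := by
          simpa using ((hasDerivAt_id x).sub_const τ).const_mul κ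
        exact (((hGd x).sub_const _).sub h1).const_add _
      · intro x hx
        have hx0 : 0 ≤ x := hτ.1.trans hx.1
        have hxm := hτm x ⟨hx.1, hx.2.le⟩
        have hfx : 0 < f x := hm.trans_le hxm
        set p := x ^ 2 * s + x with hp
        have hp0 : 0 ≤ p := by positivity
        have hpσ : m * S + p ≤ D := by
          have : x ^ 2 ≤ σ ^ 2 := by gcongr; exact hx.2.le
          have := mul_le_mul_of_nonneg_right this hs.le
          rw [hp, hD]; linarith [hx.2]
        have e1 : f x * S + x ^ 2 * s + x = f x * S + p := by rw [hp]; ring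
        have e2 : f 0 * S + x ^ 2 * s + x = f 0 * S + p := by rw [hp]; ring
        simp only [e1, e2]
        have hA : 0 < f 0 * S + p := by positivity
        have hB : 0 < m * S + p := by positivity
        have hle : 2 / (f x * S + p) ≤ 2 / (m * S + p) := by gcongr
        have hκle : κ ≤ 2 / (f 0 * S + p) - 2 / (m * S + p) := by
          have : 2 / (f 0 * S + p) - 2 / (m * S + p)
              = 2 * (m - f 0) * S / ((f 0 * S + p) * (m * S + p)) := by
            field_simp; ring
          rw [this, hκ]
          have hmf : 0 < m - f 0 := by linarith
          have hle1 : f 0 * S + p ≤ D := by nlinarith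
          gcongr
          rw [sq]; gcongr
        have : 2 * f x / (f x * S + p) = 2 / (f x * S + p) * f x := by ring
        rw [this]
        gcongr
        linarith
    have : 0 < κ * (σ - τ) := mul_pos hκ0 (by linarith [hτ.2])
    linarith

end DiniComparison

/-! ### Primitives and the Volterra operator on `L²([0, ℓ])`. -/

namespace IntervalL2

open scoped InnerProductSpace BoundedContinuousFunction

/-- The Hilbert space `L²([0, ℓ])`. -/
abbrev EdgeL2 (ℓ : ℝ) : Type := Lp ℂ 2 (volume.restrict (Set.Icc (0 : ℝ) ℓ))

variable {ℓ : ℝ}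

lemma inner_eq_integral (hℓ : 0 < ℓ) {f g : EdgeL2 ℓ} {u w : ℝ → ℂ}
    (hf : f =ᵐ[volume.restrict (Set.Icc 0 ℓ)] u) (hg : g =ᵐ[volume.restrict (Set.Icc 0 ℓ)] w) :
    ⟪f, g⟫_ℂ = ∫ x in (0 : ℝ)..ℓ, starRingEnd ℂ (u x) * w x := by
  rw [L2.inner_def, intervalIntegral.integral_of_le hℓ.le, ← integral_Icc_eq_integral_Ioc]
  refine integral_congr_ae ?_
  filter_upwards [hf, hg] with x h1 h2
  rw [h1, h2, RCLike.inner_apply, mul_comm]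

/-- Cauchy–Schwarz against the indicator of `(a, b]`. This is the Hölder-1/2 bound behind
boundedness and equicontinuity of primitives. -/
lemma norm_integral_le (g : EdgeL2 ℓ) {a b : ℝ} (ha : 0 ≤ a) (hab : a ≤ b) (hb : b ≤ ℓ) :
    ‖∫ t in a..b, g t‖ ≤ √(b - a) * ‖g‖ := by
  set μ := volume.restrict (Set.Icc (0 : ℝ) ℓ)
  have hμ : μ.restrict (Set.Ioc a b) = volume.restrict (Set.Ioc a b) := by
    rw [Measure.restrict_restrict measurableSet_Ioc, Set.inter_eq_left.2]
    exact fun x hx => ⟨ha.trans hx.1.le, hx.2.trans hb⟩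
  have hμab : μ.real (Set.Ioc a b) = b - a := by
    have : μ (Set.Ioc a b) = volume (Set.Ioc a b) := by
      rw [← Measure.restrict_apply_univ (μ := μ), hμ, Measure.restrict_apply_univ]
    rw [measureReal_def, this, Real.volume_Ioc, ENNReal.toReal_ofReal (by linarith)]
  have h := L2.inner_indicatorConstLp_one (𝕜 := ℂ) (measurableSet_Ioc (a := a) (b := b))
    (measure_ne_top μ _) g
  rw [hμ, ← intervalIntegral.integral_of_le hab] at h
  rw [← h]
  refine (norm_inner_le_norm _ _).trans ?_
  rw [norm_indicatorConstLp (by norm_num) (by norm_num), hμab, Real.sqrt_eq_rpow]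
  simp

lemma intervalIntegrable_of_mem (hℓ : 0 < ℓ) (g : EdgeL2 ℓ) {x : ℝ} (hx : x ∈ Set.Icc 0 ℓ) :
    IntervalIntegrable g volume 0 x :=
  MetricGraph.intervalIntegrable_sub (MetricGraph.edge_intervalIntegrable hℓ.le g) hx

lemma continuousOn_primitive (hℓ : 0 < ℓ) (g : EdgeL2 ℓ) :
    ContinuousOn (fun x => ∫ t in (0 : ℝ)..x, g t) (Set.Icc 0 ℓ) := by
  have := intervalIntegral.continuousOn_primitive_interval'
    (MetricGraph.edge_intervalIntegrable hℓ.le g) Set.left_mem_uIcc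
  rwa [Set.uIcc_of_le hℓ.le] at this

lemma integral_congr_Icc {u w : ℝ → ℂ} (h : u =ᵐ[volume.restrict (Set.Icc 0 ℓ)] w) {x : ℝ}
    (hx : x ∈ Set.Icc 0 ℓ) : ∫ t in (0 : ℝ)..x, u t = ∫ t in (0 : ℝ)..x, w t :=
  MetricGraph.integral_congr_edge h hx

/-- The primitive `x ↦ ∫₀ˣ g` as a linear map into the continuous functions. -/
noncomputable def primₗ (hℓ : 0 < ℓ) : EdgeL2 ℓ →ₗ[ℂ] (Set.Icc (0 : ℝ) ℓ →ᵇ ℂ) where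
  toFun g := BoundedContinuousFunction.mkOfCompact
    ⟨fun x => ∫ t in (0 : ℝ)..x, g t, (continuousOn_primitive hℓ g).comp_continuous
      continuous_subtype_val fun x => x.2⟩
  map_add' f g := by
    ext x
    change ∫ t in (0 : ℝ)..x, (f + g : EdgeL2 ℓ) t
      = (∫ t in (0 : ℝ)..x, f t) + ∫ t in (0 : ℝ)..x, g t
    rw [integral_congr_Icc (Lp.coeFn_add f g) x.2]
    exact intervalIntegral.integral_add (intervalIntegrable_of_mem hℓ f x.2)
      (intervalIntegrable_of_mem hℓ g x.2)
  map_smul' c f := by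
    ext x
    change ∫ t in (0 : ℝ)..x, (c • f : EdgeL2 ℓ) t = c • ∫ t in (0 : ℝ)..x, f t
    rw [integral_congr_Icc (Lp.coeFn_smul c f) x.2]
    exact intervalIntegral.integral_smul c _

/-- The primitive `x ↦ ∫₀ˣ g` as a bounded operator into the continuous functions. -/
noncomputable def prim (hℓ : 0 < ℓ) : EdgeL2 ℓ →L[ℂ] (Set.Icc (0 : ℝ) ℓ →ᵇ ℂ) :=
  (primₗ hℓ).mkContinuous √ℓ fun g => by
    rw [BoundedContinuousFunction.norm_le (by positivity)]
    intro x
    refine (norm_integral_le g le_rfl x.2.1 x.2.2).trans ?_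
    gcongr
    linarith [x.2.2]

lemma prim_apply (hℓ : 0 < ℓ) (g : EdgeL2 ℓ) (x : Set.Icc (0 : ℝ) ℓ) :
    prim hℓ g x = ∫ t in (0 : ℝ)..x, g t := rfl

lemma dist_prim_le (hℓ : 0 < ℓ) (g : EdgeL2 ℓ) (x y : Set.Icc (0 : ℝ) ℓ) :
    dist (prim hℓ g x) (prim hℓ g y) ≤ √(dist x y) * ‖g‖ := by
  wlog h : (y : ℝ) ≤ x generalizing x y
  · rw [dist_comm, dist_comm x]; exact this y x (le_of_not_ge h)
  rw [dist_eq_norm, prim_apply, prim_apply, intervalIntegral.integral_interval_sub_left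
    (intervalIntegrable_of_mem hℓ g x.2) (intervalIntegrable_of_mem hℓ g y.2)]
  refine (norm_integral_le g y.2.1 h x.2.2).trans ?_
  rw [Subtype.dist_eq, Real.dist_eq, abs_of_nonneg (sub_nonneg.2 h)]

/-- Arzelà–Ascoli: primitives of the unit ball are bounded by `√ℓ` and share the modulus of
continuity `√r`. -/
lemma isCompactOperator_prim (hℓ : 0 < ℓ) : IsCompactOperator (prim hℓ) := by
  rw [isCompactOperator_iff_exists_mem_nhds_isCompact_closure_image]
  refine ⟨Metric.ball 0 1, Metric.ball_mem_nhds _ one_pos, ?_⟩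
  refine BoundedContinuousFunction.arzela_ascoli (Metric.closedBall (0 : ℂ) √ℓ)
    (isCompact_closedBall _ _) _ ?_ ?_
  · rintro _ x ⟨g, hg, rfl⟩
    rw [mem_closedBall_zero_iff]
    refine (norm_integral_le g le_rfl x.2.1 x.2.2).trans ?_
    have h1 : ‖g‖ ≤ 1 := (mem_ball_zero_iff.1 hg).le
    calc √((x : ℝ) - 0) * ‖g‖ ≤ √ℓ * 1 := by
          gcongr
          linarith [x.2.2]
      _ = √ℓ := mul_one _
  · refine Metric.equicontinuous_of_continuity_modulus (fun r => √r) ?_ _ ?_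
    · have : ContinuousAt (fun r : ℝ => √r) 0 := Real.continuous_sqrt.continuousAt
      simpa [ContinuousAt] using this
    · rintro x y ⟨_, g, hg, rfl⟩
      have h1 : ‖g‖ ≤ 1 := (mem_ball_zero_iff.1 hg).le
      refine (dist_prim_le hℓ g x y).trans ?_
      calc √(dist x y) * ‖g‖ ≤ √(dist x y) * 1 := by gcongr
        _ = _ := mul_one _

/-- The continuous extension of a function on `[0, ℓ]` that is constant outside `[0, ℓ]`. -/
noncomputable def extendₗ (hℓ : 0 < ℓ) : (Set.Icc (0 : ℝ) ℓ →ᵇ ℂ) →ₗ[ℂ] (ℝ →ᵇ ℂ) where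
  toFun f := f.compContinuous ⟨Set.projIcc 0 ℓ hℓ.le, continuous_projIcc⟩
  map_add' _ _ := rfl
  map_smul' _ _ := rfl

/-- The inclusion of the continuous functions on `[0, ℓ]` into `L²([0, ℓ])`. -/
noncomputable def incl (hℓ : 0 < ℓ) : (Set.Icc (0 : ℝ) ℓ →ᵇ ℂ) →L[ℂ] EdgeL2 ℓ :=
  (BoundedContinuousFunction.toLp 2 (volume.restrict (Set.Icc (0 : ℝ) ℓ)) ℂ).comp <|
    (extendₗ hℓ).mkContinuous 1 fun f => by
      rw [one_mul, BoundedContinuousFunction.norm_le (norm_nonneg _)]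
      exact fun x => f.norm_coe_le_norm _

lemma coeFn_incl (hℓ : 0 < ℓ) (f : Set.Icc (0 : ℝ) ℓ →ᵇ ℂ) {u : ℝ → ℂ}
    (hu : ∀ x : Set.Icc (0 : ℝ) ℓ, f x = u x) :
    incl hℓ f =ᵐ[volume.restrict (Set.Icc 0 ℓ)] u := by
  refine (BoundedContinuousFunction.coeFn_toLp (p := 2)
    (μ := volume.restrict (Set.Icc (0 : ℝ) ℓ)) (𝕜 := ℂ) (extendₗ hℓ f)).trans ?_
  filter_upwards [ae_restrict_mem measurableSet_Icc] with x hx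
  change f (Set.projIcc 0 ℓ hℓ.le x) = u x
  rw [hu, Set.projIcc_of_mem hℓ.le hx]

/-- The constant function `1` in `L²([0, ℓ])`. -/
noncomputable def one (hℓ : 0 < ℓ) : EdgeL2 ℓ := incl hℓ (BoundedContinuousFunction.const _ 1)

lemma coeFn_one (hℓ : 0 < ℓ) : one hℓ =ᵐ[volume.restrict (Set.Icc 0 ℓ)] fun _ => (1 : ℂ) :=
  coeFn_incl hℓ _ fun _ => rfl

/-- The Volterra operator on `L²([0, ℓ])`. -/
noncomputable def volterra (hℓ : 0 < ℓ) : EdgeL2 ℓ →L[ℂ] EdgeL2 ℓ := (incl hℓ).comp (prim hℓ)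

lemma coeFn_volterra (hℓ : 0 < ℓ) (g : EdgeL2 ℓ) :
    volterra hℓ g =ᵐ[volume.restrict (Set.Icc 0 ℓ)] fun x => ∫ t in (0 : ℝ)..x, g t :=
  coeFn_incl hℓ _ fun _ => rfl

lemma isCompactOperator_volterra (hℓ : 0 < ℓ) : IsCompactOperator (volterra hℓ) := by
  have : IsCompactOperator (incl hℓ ∘ prim hℓ) := (isCompactOperator_prim hℓ).clm_comp _
  exact this

/-- The integral over `[0, ℓ]` as a bounded functional. -/
noncomputable def total (hℓ : 0 < ℓ) : EdgeL2 ℓ →L[ℂ] ℂ := innerSL ℂ (one hℓ)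

lemma total_eq_inner (hℓ : 0 < ℓ) (g : EdgeL2 ℓ) : total hℓ g = ⟪one hℓ, g⟫_ℂ := rfl

lemma total_apply (hℓ : 0 < ℓ) (g : EdgeL2 ℓ) : total hℓ g = ∫ t in (0 : ℝ)..ℓ, g t := by
  rw [total_eq_inner, inner_eq_integral hℓ (coeFn_one hℓ) (Filter.EventuallyEq.refl _ _)]
  simp

lemma total_one (hℓ : 0 < ℓ) : total hℓ (one hℓ) = ℓ := by
  rw [total_eq_inner, inner_eq_integral hℓ (coeFn_one hℓ) (coeFn_one hℓ)]
  simp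

/-- For continuous data the primitives are differentiable everywhere, so the classical product rule
applies; density then gives the `L²` statement. -/
lemma inner_volterra_of_continuous (hℓ : 0 < ℓ) (p q : ℝ →ᵇ ℂ) {f g : EdgeL2 ℓ}
    (hf : f =ᵐ[volume.restrict (Set.Icc 0 ℓ)] p) (hg : g =ᵐ[volume.restrict (Set.Icc 0 ℓ)] q) :
    ⟪f, volterra hℓ g⟫_ℂ + ⟪volterra hℓ f, g⟫_ℂ
      = starRingEnd ℂ (total hℓ f) * total hℓ g := by
  have hV : ∀ {f : EdgeL2 ℓ} {p : ℝ →ᵇ ℂ}, f =ᵐ[volume.restrict (Set.Icc 0 ℓ)] p →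
      volterra hℓ f =ᵐ[volume.restrict (Set.Icc 0 ℓ)] fun x => ∫ t in (0 : ℝ)..x, p t := by
    intro f p hf
    refine (coeFn_volterra hℓ f).trans ?_
    filter_upwards [ae_restrict_mem measurableSet_Icc] with x hx
    exact integral_congr_Icc hf hx
  have hd : ∀ (p : ℝ →ᵇ ℂ) x, HasDerivAt (fun x => ∫ t in (0 : ℝ)..x, p t) (p x) x := fun p x =>
    intervalIntegral.integral_hasDerivAt_right (p.continuous.intervalIntegrable _ _)
      (p.continuous.stronglyMeasurableAtFilter _ _) p.continuous.continuousAt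
  have hℓm : ℓ ∈ Set.Icc 0 ℓ := ⟨hℓ.le, le_rfl⟩
  rw [inner_eq_integral hℓ hf (hV hg), inner_eq_integral hℓ (hV hf) hg, total_apply, total_apply,
    integral_congr_Icc hf hℓm, integral_congr_Icc hg hℓm]
  have hcP : Continuous fun x => ∫ t in (0 : ℝ)..x, p t :=
    continuous_iff_continuousAt.2 fun x => (hd p x).continuousAt
  have hcQ : Continuous fun x => ∫ t in (0 : ℝ)..x, q t :=
    continuous_iff_continuousAt.2 fun x => (hd q x).continuousAt
  have hcp := p.continuous
  have hcq := q.continuous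
  have := intervalIntegral.integral_deriv_mul_eq_sub (a := 0) (b := ℓ)
    (u := fun x => starRingEnd ℂ (∫ t in (0 : ℝ)..x, p t)) (u' := fun x => starRingEnd ℂ (p x))
    (v := fun x => ∫ t in (0 : ℝ)..x, q t) (v' := q)
    (fun x _ => (hd p x).star) (fun x _ => hd q x)
    ((Complex.continuous_conj.comp hcp).intervalIntegrable _ _) (hcq.intervalIntegrable _ _)
  rw [← intervalIntegral.integral_add]
  · rw [this]; simp
  · exact ((Complex.continuous_conj.comp hcp).mul hcQ).intervalIntegrable _ _
  · exact ((Complex.continuous_conj.comp hcP).mul hcq).intervalIntegrable _ _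

/-- Integration by parts for primitives of `L²` functions. -/
lemma inner_volterra (hℓ : 0 < ℓ) (f g : EdgeL2 ℓ) :
    ⟪f, volterra hℓ g⟫_ℂ + ⟪volterra hℓ f, g⟫_ℂ
      = starRingEnd ℂ (total hℓ f) * total hℓ g := by
  have hdense := BoundedContinuousFunction.toLp_denseRange ℂ
    (volume.restrict (Set.Icc (0 : ℝ) ℓ)) (p := 2) ℂ (by norm_num)
  refine hdense.induction_on₂ (p := fun f g => ⟪f, volterra hℓ g⟫_ℂ + ⟪volterra hℓ f, g⟫_ℂ
      = starRingEnd ℂ (total hℓ f) * total hℓ g) ?_ ?_ f g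
  · refine isClosed_eq ?_ ?_
    · fun_prop
    · exact (Complex.continuous_conj.comp (by fun_prop)).mul (by fun_prop)
  · intro p q
    exact inner_volterra_of_continuous hℓ p q
      (BoundedContinuousFunction.coeFn_toLp 2 _ ℂ p) (BoundedContinuousFunction.coeFn_toLp 2 _ ℂ q)

end IntervalL2

/-! ### The Sobolev space `H¹(Γ)`, its compact inclusion, traces and Green's formula. -/

namespace MetricGraph

open IntervalL2
open scoped InnerProductSpace

variable {V E : Type*} [Fintype E] (G : MetricGraph V E)

/-- Pairs of a derivative and a function in `L²(Γ)`. -/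
abbrev PairSpace : Type _ := WithLp 2 (G.L2 × G.L2)

/-- The first entry (the derivative) on the edge `e`. -/
noncomputable def derivOn (e : E) : G.PairSpace →L[ℂ] EdgeL2 (G.len e) :=
  (PiLp.proj 2 (fun e : E => EdgeL2 (G.len e)) e).comp (WithLp.fstL 2 ℂ G.L2 G.L2)

/-- The second entry (the function) on the edge `e`. -/
noncomputable def funOn (e : E) : G.PairSpace →L[ℂ] EdgeL2 (G.len e) :=
  (PiLp.proj 2 (fun e : E => EdgeL2 (G.len e)) e).comp (WithLp.sndL 2 ℂ G.L2 G.L2)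

/-- The mean of `f - ∫₀ˣ f'`, i.e. the value `f 0` if `f` is a primitive of `f'`. -/
noncomputable def startVal (e : E) : G.PairSpace →L[ℂ] ℂ :=
  ((G.len e : ℂ)⁻¹) • (total (G.len_pos e)).comp
    (G.funOn e - (volterra (G.len_pos e)).comp (G.derivOn e))

/-- The value at the endpoint `b` of the edge `e`. -/
noncomputable def endVal (e : E) (b : Bool) : G.PairSpace →L[ℂ] ℂ :=
  G.startVal e + if b then (total (G.len_pos e)).comp (G.derivOn e) else 0

lemma endVal_false (e : E) (p : G.PairSpace) : G.endVal e false p = G.startVal e p := by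
  simp [endVal]

lemma endVal_true (e : E) (p : G.PairSpace) :
    G.endVal e true p = G.startVal e p + total (G.len_pos e) (G.derivOn e p) := by
  simp [endVal]

/-- The Sobolev space `H¹(Γ)` of functions that are continuous at the vertices, embedded into
`L²(Γ) ⊕ L²(Γ)` by `f ↦ (f', f)`. -/
def sobolev : Submodule ℂ G.PairSpace where
  carrier := {p | (∀ e, G.funOn e p =
      G.startVal e p • one (G.len_pos e) + volterra (G.len_pos e) (G.derivOn e p)) ∧
    ∀ e b e' b', G.vert e b = G.vert e' b' → G.endVal e b p = G.endVal e' b' p}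
  zero_mem' := by simp
  add_mem' := by
    rintro p q ⟨hp, hp'⟩ ⟨hq, hq'⟩
    refine ⟨fun e => ?_, fun e b e' b' h => ?_⟩
    · simp only [map_add, hp e, hq e, add_smul]; abel
    · rw [map_add, map_add, hp' e b e' b' h, hq' e b e' b' h]
  smul_mem' := by
    rintro c p ⟨hp, hp'⟩
    refine ⟨fun e => ?_, fun e b e' b' h => ?_⟩
    · simp only [map_smul, hp e, smul_add, smul_assoc]
    · rw [map_smul, map_smul, hp' e b e' b' h]

lemma isClosed_sobolev : IsClosed (G.sobolev : Set G.PairSpace) := by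
  have h : (G.sobolev : Set G.PairSpace) = {p | (∀ e, G.funOn e p =
      G.startVal e p • one (G.len_pos e) + volterra (G.len_pos e) (G.derivOn e p)) ∧
    ∀ e b e' b', G.vert e b = G.vert e' b' → G.endVal e b p = G.endVal e' b' p} := rfl
  rw [h]
  simp only [Set.ofPred_and, Set.ofPred_forall]
  refine IsClosed.inter (isClosed_iInter fun e => isClosed_eq (by fun_prop) ?_) ?_
  · exact ((G.startVal e).continuous.smul continuous_const).add
      ((volterra _).continuous.comp (G.derivOn e).continuous)
  · exact isClosed_iInter fun e => isClosed_iInter fun b => isClosed_iInter fun e' =>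
      isClosed_iInter fun b' => isClosed_iInter fun _ =>
        isClosed_eq (G.endVal e b).continuous (G.endVal e' b').continuous

instance : CompleteSpace G.sobolev := G.isClosed_sobolev.completeSpace_coe

variable {G}

lemma funOn_eq (x : G.sobolev) (e : E) : G.funOn e x =
    G.startVal e x • one (G.len_pos e) + volterra (G.len_pos e) (G.derivOn e x) := x.2.1 e

lemma endVal_eq_of_vert_eq (x : G.sobolev) {e e' : E} {b b' : Bool}
    (h : G.vert e b = G.vert e' b') : G.endVal e b x = G.endVal e' b' x := x.2.2 e b e' b' h

lemma coeFn_funOn (x : G.sobolev) (e : E) :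
    G.funOn e x =ᵐ[volume.restrict (Set.Icc 0 (G.len e))]
      fun s => G.startVal e x + ∫ r in (0 : ℝ)..s, G.derivOn e x r := by
  rw [funOn_eq]
  filter_upwards [Lp.coeFn_add (G.startVal e x • one (G.len_pos e))
    (volterra (G.len_pos e) (G.derivOn e x)), Lp.coeFn_smul (G.startVal e x) (one (G.len_pos e)),
    coeFn_one (G.len_pos e), coeFn_volterra (G.len_pos e) (G.derivOn e x)] with s h1 h2 h3 h4
  rw [h1, Pi.add_apply, h2, Pi.smul_apply, h3, h4, smul_eq_mul, mul_one]

/-- The vertex values of an `H¹` function. -/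
lemma exists_vertexValue (x : G.sobolev) :
    ∃ ψ : V → ℂ, ∀ e b, G.endVal e b x = ψ (G.vert e b) := by
  classical
  refine ⟨fun v => if h : ∃ p : E × Bool, G.vert p.1 p.2 = v then
    G.endVal h.choose.1 h.choose.2 x else 0, fun e b => ?_⟩
  have h : ∃ p : E × Bool, G.vert p.1 p.2 = G.vert e b := ⟨(e, b), rfl⟩
  dsimp only
  rw [dif_pos h]
  exact endVal_eq_of_vert_eq x h.choose_spec.symm

variable (G) in
/-- The pair of a derivative `γ` and its primitive with initial values `c`. -/
noncomputable def primitivePair (c : E → ℂ) (γ : G.L2) : G.PairSpace :=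
  WithLp.toLp 2 (γ, WithLp.toLp 2 fun e =>
    c e • one (G.len_pos e) + volterra (G.len_pos e) (γ e))

lemma derivOn_primitivePair (c : E → ℂ) (γ : G.L2) (e : E) :
    G.derivOn e (G.primitivePair c γ) = γ e := rfl

lemma funOn_primitivePair (c : E → ℂ) (γ : G.L2) (e : E) :
    G.funOn e (G.primitivePair c γ) =
      c e • one (G.len_pos e) + volterra (G.len_pos e) (γ e) := rfl

lemma startVal_primitivePair (c : E → ℂ) (γ : G.L2) (e : E) :
    G.startVal e (G.primitivePair c γ) = c e := by
  have h : (G.len e : ℂ) ≠ 0 := by exact_mod_cast (G.len_pos e).ne'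
  change (G.len e : ℂ)⁻¹ • total (G.len_pos e) (G.funOn e (G.primitivePair c γ) -
    volterra (G.len_pos e) (G.derivOn e (G.primitivePair c γ))) = c e
  rw [funOn_primitivePair, derivOn_primitivePair, add_sub_cancel_right, map_smul, total_one,
    smul_eq_mul, smul_eq_mul]
  field_simp

lemma endVal_primitivePair {c : E → ℂ} {γ : G.L2} {ψ : V → ℂ}
    (h0 : ∀ e, c e = ψ (G.vert e false))
    (h1 : ∀ e, c e + total (G.len_pos e) (γ e) = ψ (G.vert e true)) (e : E) (b : Bool) :
    G.endVal e b (G.primitivePair c γ) = ψ (G.vert e b) := by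
  cases b
  · rw [endVal_false, startVal_primitivePair, h0]
  · rw [endVal_true, startVal_primitivePair, derivOn_primitivePair, h1]

lemma primitivePair_mem_sobolev {c : E → ℂ} {γ : G.L2} {ψ : V → ℂ}
    (h0 : ∀ e, c e = ψ (G.vert e false))
    (h1 : ∀ e, c e + total (G.len_pos e) (γ e) = ψ (G.vert e true)) :
    G.primitivePair c γ ∈ G.sobolev := by
  refine ⟨fun e => ?_, fun e b e' b' h => ?_⟩
  · rw [startVal_primitivePair, funOn_primitivePair, derivOn_primitivePair]
  · rw [endVal_primitivePair h0 h1, endVal_primitivePair h0 h1, h]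

variable (G)

/-- The inclusion `H¹(Γ) → L²(Γ)`. -/
noncomputable def sobolevIncl : G.sobolev →L[ℂ] G.L2 :=
  (WithLp.sndL 2 ℂ G.L2 G.L2).comp G.sobolev.subtypeL

variable {G}

lemma sobolevIncl_apply (x : G.sobolev) (e : E) : G.sobolevIncl x e = G.funOn e x := rfl

lemma inner_sobolev (x y : G.sobolev) : ⟪x, y⟫_ℂ =
    ∑ e, ⟪G.derivOn e x, G.derivOn e y⟫_ℂ + ⟪G.sobolevIncl x, G.sobolevIncl y⟫_ℂ := by
  rw [Submodule.coe_inner, WithLp.prod_inner_apply]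
  congr 1

lemma inner_sobolevIncl (x y : G.sobolev) :
    ⟪G.sobolevIncl x, G.sobolevIncl y⟫_ℂ = ∑ e, ⟪G.funOn e x, G.funOn e y⟫_ℂ := by
  rw [PiLp.inner_apply]; rfl

variable (G) in
-- On each edge the function is a starting value times `1` plus the Volterra operator applied to the
-- derivative: a rank-one map plus a compact one. The inclusion is the finite sum of these over the
-- edges.
lemma isCompactOperator_sobolevIncl : IsCompactOperator G.sobolevIncl := by
  classical
  let A : ∀ e, G.sobolev →L[ℂ] EdgeL2 (G.len e) := fun e =>
    ((ContinuousLinearMap.id ℂ ℂ).smulRight (one (G.len_pos e))).comp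
        ((G.startVal e).comp G.sobolev.subtypeL) +
      (volterra (G.len_pos e)).comp ((G.derivOn e).comp G.sobolev.subtypeL)
  have hA : ∀ e, IsCompactOperator (A e) := by
    intro e
    refine IsCompactOperator.add ?_ ?_
    · have h1 : IsCompactOperator ((G.startVal e).comp G.sobolev.subtypeL) :=
        isCompactOperator_of_locallyCompactSpace_dom _
      exact h1.clm_comp ((ContinuousLinearMap.id ℂ ℂ).smulRight (one (G.len_pos e)))
    · exact (isCompactOperator_volterra (G.len_pos e)).comp_clm
        ((G.derivOn e).comp G.sobolev.subtypeL)
  let L : ∀ e, EdgeL2 (G.len e) →L[ℂ] G.L2 := fun e =>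
    (PiLp.continuousLinearEquiv 2 ℂ (fun e : E => EdgeL2 (G.len e))).symm.toContinuousLinearMap.comp
      (ContinuousLinearMap.single ℂ (fun e : E => EdgeL2 (G.len e)) e)
  have hsum : G.sobolevIncl = ∑ e, (L e).comp (A e) := by
    ext1 x
    refine PiLp.ext fun e => ?_
    rw [sobolevIncl_apply, funOn_eq, sum_apply, WithLp.ofLp_sum,
      Finset.sum_apply]
    have : ∀ e', (((L e').comp (A e')) x : G.L2) e = (Pi.single e' (A e' x) : ∀ e, EdgeL2 (G.len e)) e :=
      fun e' => rfl
    simp only [this]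
    rw [Finset.sum_pi_single]
    simp [A]
  rw [hsum]
  have : ∑ e, (L e).comp (A e) ∈ compactOperator (RingHom.id ℂ) G.sobolev G.L2 :=
    Submodule.sum_mem _ fun e _ => by
      have : IsCompactOperator (L e ∘ A e) := (hA e).clm_comp (L e)
      exact this
  exact this

/-- The function determines its derivative, since a primitive that vanishes identically has an
integrand vanishing almost everywhere. This carries linear independence from `H¹` to `L²`. -/
lemma sobolevIncl_injective : Function.Injective G.sobolevIncl := by
  rw [injective_iff_map_eq_zero]
  intro x hx
  have hf : ∀ e, G.funOn e x = 0 := fun e => by rw [← sobolevIncl_apply, hx]; rfl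
  have hd : ∀ e, G.derivOn e x = 0 := by
    intro e
    have hℓ := G.len_pos e
    have hcont : ContinuousOn (fun s => G.startVal e x + ∫ r in (0 : ℝ)..s, G.derivOn e x r)
        (Set.Icc 0 (G.len e)) := continuousOn_const.add (continuousOn_primitive hℓ _)
    have h0 := coeFn_funOn x e
    rw [hf e] at h0
    have heq := Measure.eqOn_Icc_of_ae_eq volume hℓ.ne
      (h0.symm.trans (Lp.coeFn_zero ℂ 2 _)) hcont continuousOn_const
    have hs : G.startVal e x = 0 := by simpa using heq (⟨le_rfl, hℓ.le⟩ : (0 : ℝ) ∈ Set.Icc 0 _)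
    have := ae_zero_of_primitive_zero hℓ.le (edge_intervalIntegrable hℓ.le (G.derivOn e x))
      fun s hs' => by simpa [hs] using heq hs'
    exact Lp.ext (this.trans (Lp.coeFn_zero ℂ 2 _).symm)
  refine Subtype.ext ?_
  rw [Submodule.coe_zero]
  refine (WithLp.ofLp_injective 2) (Prod.ext ?_ ?_)
  · exact PiLp.ext hd
  · exact PiLp.ext hf

variable (G) in
/-- The vector of the values of an `H¹` function at the vertices of `VR`, where `h v` is an edge
end at `v`. -/
noncomputable def trace (VR : Finset V) (h : V → E × Bool) :
    G.sobolev →L[ℂ] EuclideanSpace ℂ VR :=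
  (PiLp.continuousLinearEquiv 2 ℂ (fun _ : VR => ℂ)).symm.toContinuousLinearMap.comp
    (ContinuousLinearMap.pi fun v : VR =>
      (G.endVal (h v).1 (h v).2).comp G.sobolev.subtypeL)

lemma trace_apply (VR : Finset V) (h : V → E × Bool) (x : G.sobolev) (v : VR) :
    G.trace VR h x v = G.endVal (h v).1 (h v).2 x := rfl

lemma inner_trace {VR : Finset V} {h : V → E × Bool} (hh : ∀ v ∈ VR, G.vert (h v).1 (h v).2 = v)
    {x y : G.sobolev} {φ ψ : V → ℂ} (hx : ∀ e b, G.endVal e b x = φ (G.vert e b))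
    (hy : ∀ e b, G.endVal e b y = ψ (G.vert e b)) :
    ⟪G.trace VR h x, G.trace VR h y⟫_ℂ = ∑ v ∈ VR, starRingEnd ℂ (φ v) * ψ v := by
  rw [PiLp.inner_apply, ← Finset.sum_coe_sort VR]
  refine Finset.sum_congr rfl fun v _ => ?_
  rw [RCLike.inner_apply, trace_apply, trace_apply, hx, hy, hh v v.2, mul_comm]

lemma norm_sq_trace {VR : Finset V} {h : V → E × Bool}
    (hh : ∀ v ∈ VR, G.vert (h v).1 (h v).2 = v)
    {x : G.sobolev} {φ : V → ℂ} (hx : ∀ e b, G.endVal e b x = φ (G.vert e b)) :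
    ‖G.trace VR h x‖ ^ 2 = ∑ v ∈ VR, ‖φ v‖ ^ 2 := by
  rw [EuclideanSpace.norm_sq_eq, ← Finset.sum_coe_sort VR]
  refine Finset.sum_congr rfl fun v _ => ?_
  rw [trace_apply, hx, hh v v.2]

lemma sum_halfEdges [Fintype V] [DecidableEq V] {M : Type*} [AddCommMonoid M] (a : E × Bool → M) :
    ∑ v, ∑ h ∈ G.halfEdges v, a h = ∑ e, (a (e, false) + a (e, true)) := by
  unfold halfEdges
  rw [Finset.sum_fiberwise, Fintype.sum_prod_type]
  simp [add_comm]

/-- Integration by parts on one edge. -/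
lemma green_edge {ℓ : ℝ} (hℓ : 0 < ℓ) (f γ : EdgeL2 ℓ) (d c : ℂ) (μ : ℝ) :
    ⟪d • one hℓ + volterra hℓ (-((μ : ℂ) • f)), γ⟫_ℂ
      = μ * ⟪f, c • one hℓ + volterra hℓ γ⟫_ℂ
        + (starRingEnd ℂ (d + total hℓ (-((μ : ℂ) • f))) * (c + total hℓ γ)
          - starRingEnd ℂ d * c) := by
  have h1 := inner_volterra hℓ (-((μ : ℂ) • f)) γ
  have h2 : ⟪f, one hℓ⟫_ℂ = starRingEnd ℂ (total hℓ f) := by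
    rw [total_eq_inner, inner_conj_symm]
  simp only [inner_neg_left, inner_smul_left, Complex.conj_ofReal, map_neg, map_smul,
    smul_eq_mul, map_mul] at h1
  simp only [inner_add_left, inner_add_right, inner_smul_left, inner_smul_right, map_neg,
    map_smul, inner_neg_left, Complex.conj_ofReal, smul_eq_mul, map_add, map_mul, h2,
    ← total_eq_inner] at h1 ⊢
  linear_combination h1

/-- Green's formula, where `a h` are the outward derivatives at the edge ends `h`. -/
lemma green [Fintype V] [DecidableEq V] {x y : G.sobolev} {μ : ℝ} {d : E → ℂ}
    (hd : ∀ e, G.derivOn e x = d e • one (G.len_pos e) +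
      volterra (G.len_pos e) (-((μ : ℂ) • G.funOn e x)))
    {a : E × Bool → ℂ} (ha0 : ∀ e, a (e, false) = d e)
    (ha1 : ∀ e, a (e, true) = -(d e + total (G.len_pos e) (-((μ : ℂ) • G.funOn e x))))
    {ψ : V → ℂ} (hy : ∀ e b, G.endVal e b y = ψ (G.vert e b)) :
    ⟪x, y⟫_ℂ = (((μ + 1 : ℝ) : ℂ)) * ⟪G.sobolevIncl x, G.sobolevIncl y⟫_ℂ
      - ∑ v, starRingEnd ℂ (∑ h ∈ G.halfEdges v, a h) * ψ v := by
  have hsum : ∑ v, starRingEnd ℂ (∑ h ∈ G.halfEdges v, a h) * ψ v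
      = ∑ e, (starRingEnd ℂ (a (e, false)) * ψ (G.vert e false)
        + starRingEnd ℂ (a (e, true)) * ψ (G.vert e true)) := by
    rw [← sum_halfEdges (G := G) fun h => starRingEnd ℂ (a h) * ψ (G.vert h.1 h.2)]
    refine Finset.sum_congr rfl fun v _ => ?_
    rw [map_sum, Finset.sum_mul]
    refine Finset.sum_congr rfl fun h hh => ?_
    rw [(Finset.mem_filter.1 hh).2]
  have hedge : ∀ e, ⟪G.derivOn e x, G.derivOn e y⟫_ℂ = μ * ⟪G.funOn e x, G.funOn e y⟫_ℂ
      - (starRingEnd ℂ (a (e, false)) * ψ (G.vert e false)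
        + starRingEnd ℂ (a (e, true)) * ψ (G.vert e true)) := by
    intro e
    rw [funOn_eq y e, ← hy, ← hy, endVal_false, endVal_true, ha0, ha1, hd e,
      green_edge (G.len_pos e) (G.funOn e x) (G.derivOn e y) (d e) (G.startVal e y) μ, map_neg (starRingEnd ℂ)]
    ring
  rw [inner_sobolev, hsum, Finset.sum_congr rfl fun e _ => hedge e, Finset.sum_sub_distrib,
    ← Finset.mul_sum, ← inner_sobolevIncl]
  push_cast
  ring

end MetricGraph

/-! ### Equivalence of the operator and the form eigenvalue problems. -/

namespace MetricGraph

open IntervalL2 FormSpectrum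
open scoped InnerProductSpace

variable {V E : Type*} [Fintype E] {G : MetricGraph V E} [DecidableEq V]

lemma inEigenspace_iff {VR : Finset V} {t μ : ℝ} {f : G.L2} :
    G.InEigenspace VR t μ f ↔ ∃ (u u' : E → ℝ → ℂ) (φ : V → ℂ),
      (∀ e, IsSobolevRep (G.len e) (f e) (-((μ : ℂ) • f e)) (u e) (u' e)) ∧
      G.VertexConditions VR t u u' φ := by
  have h1 : G.InEigenspace VR t μ f ↔ (f, (μ : ℂ) • f) ∈ (G.robinLaplacian VR t).graph := by
    rw [LinearPMap.mem_graph_iff]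
    constructor
    · rintro ⟨hf, h⟩; exact ⟨⟨f, hf⟩, rfl, h⟩
    · rintro ⟨⟨y, hy⟩, rfl, h⟩; exact ⟨hy, h⟩
  rw [h1, robinLaplacian_graph]
  rfl

/-- The vertex conditions turn the boundary term of Green's formula into `t` times the inner product
of the traces, which cancels the Robin term of the form. -/
lemma sum_vertex_eq [Fintype V] {VR : Finset V} {t : ℝ} {a : E × Bool → ℂ} {φ : V → ℂ}
    (hr : ∀ v ∈ VR, ∑ h ∈ G.halfEdges v, a h = t * φ v)
    (hk : ∀ v ∉ VR, ∑ h ∈ G.halfEdges v, a h = 0) (ψ : V → ℂ) :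
    ∑ v, starRingEnd ℂ (∑ h ∈ G.halfEdges v, a h) * ψ v
      = t * ∑ v ∈ VR, starRingEnd ℂ (φ v) * ψ v := by
  rw [← Finset.sum_subset (Finset.subset_univ VR), Finset.mul_sum]
  · refine Finset.sum_congr rfl fun v hv => ?_
    rw [hr v hv, map_mul, Complex.conj_ofReal, mul_assoc]
  · intro v _ hv
    rw [hk v hv, map_zero, zero_mul]

lemma IsSobolevRep.total_snd {ℓ : ℝ} (hℓ : 0 < ℓ) {f g : EdgeL2 ℓ} {u u' : ℝ → ℂ}
    (h : IsSobolevRep ℓ f g u u') : u' ℓ = u' 0 + total hℓ g := by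
  rw [total_apply]
  exact h.integral_snd ℓ ⟨hℓ.le, le_rfl⟩

lemma coeFn_const_add_volterra {ℓ : ℝ} (hℓ : 0 < ℓ) (d : ℂ) (g : EdgeL2 ℓ) :
    (d • one hℓ + volterra hℓ g : EdgeL2 ℓ) =ᵐ[volume.restrict (Set.Icc 0 ℓ)]
      fun s => d + ∫ r in (0 : ℝ)..s, g r := by
  filter_upwards [Lp.coeFn_add (d • one hℓ) (volterra hℓ g), Lp.coeFn_smul d (one hℓ),
    coeFn_one hℓ, coeFn_volterra hℓ g] with s h1 h2 h3 h4
  rw [h1, Pi.add_apply, h2, Pi.smul_apply, h3, h4, smul_eq_mul, mul_one]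

omit [DecidableEq V] in
/-- An `H¹` function with prescribed derivative and vertex values. -/
lemma exists_sobolev {c : E → ℂ} {γ : G.L2} {ψ : V → ℂ}
    (h0 : ∀ e, c e = ψ (G.vert e false))
    (h1 : ∀ e, c e + total (G.len_pos e) (γ e) = ψ (G.vert e true)) :
    ∃ x : G.sobolev, (∀ e, G.derivOn e x = γ e) ∧
      (∀ e, G.funOn e x = c e • one (G.len_pos e) + volterra (G.len_pos e) (γ e)) ∧
      ∀ e b, G.endVal e b x = ψ (G.vert e b) :=
  ⟨⟨_, primitivePair_mem_sobolev h0 h1⟩, derivOn_primitivePair c γ, funOn_primitivePair c γ,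
    endVal_primitivePair h0 h1⟩

/-- Eigenfunctions of the Robin Laplacian solve the weak eigenvalue equation. -/
lemma exists_weak_of_inEigenspace [Finite V] {VR : Finset V} {h : V → E × Bool}
    (hh : ∀ v ∈ VR, G.vert (h v).1 (h v).2 = v) {t μ : ℝ} {f : G.L2}
    (hf : G.InEigenspace VR t μ f) :
    ∃ x ∈ weakEigenspace G.sobolevIncl (G.trace VR h) t (μ + 1), G.sobolevIncl x = f := by
  have := Fintype.ofFinite V
  obtain ⟨u, u', φ, hrep, hv⟩ := inEigenspace_iff.1 hf
  obtain ⟨γ, hγ⟩ : ∃ γ : G.L2, ∀ e, γ e = u' e 0 • one (G.len_pos e) +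
      volterra (G.len_pos e) (-((μ : ℂ) • f e)) :=
    ⟨WithLp.toLp 2 fun e =>
      u' e 0 • one (G.len_pos e) + volterra (G.len_pos e) (-((μ : ℂ) • f e)), fun e => rfl⟩
  have hγu : ∀ e, γ e =ᵐ[volume.restrict (Set.Icc 0 (G.len e))] u' e := by
    intro e
    rw [hγ]
    refine (coeFn_const_add_volterra _ _ _).trans ?_
    filter_upwards [ae_restrict_mem measurableSet_Icc] with s hs
    exact ((hrep e).integral_snd s hs).symm
  have hu : ∀ e, ∀ s ∈ Set.Icc 0 (G.len e), u e 0 + ∫ r in (0 : ℝ)..s, γ e r = u e s := by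
    intro e s hs
    rw [integral_congr_Icc (hγu e) hs]
    exact ((hrep e).integral_fst s hs).symm
  have h0 : ∀ e, u e 0 = φ (G.vert e false) := fun e => by
    simpa [endCoord] using hv.cont e false
  have h1 : ∀ e, u e 0 + total (G.len_pos e) (γ e) = φ (G.vert e true) := fun e => by
    rw [total_apply, hu e _ ⟨(G.len_pos e).le, le_rfl⟩]
    simpa [endCoord] using hv.cont e true
  obtain ⟨x, hdx, hfx', hx⟩ := exists_sobolev (c := fun e => u e 0) h0 h1
  have hxf : G.sobolevIncl x = f := by
    refine PiLp.ext fun e => Lp.ext ?_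
    rw [sobolevIncl_apply, hfx']
    refine (coeFn_const_add_volterra _ _ _).trans (Filter.EventuallyEq.trans ?_ (hrep e).rep.symm)
    filter_upwards [ae_restrict_mem measurableSet_Icc] with s hs
    exact hu e s hs
  refine ⟨x, fun y => ?_, hxf⟩
  obtain ⟨ψ, hψ⟩ := exists_vertexValue y
  have hfx : ∀ e, G.funOn e x = f e := fun e => by rw [← sobolevIncl_apply, hxf]
  have hg := green (x := x) (y := y) (μ := μ) (d := fun e => u' e 0)
    (a := fun p => G.outDeriv u' p.1 p.2) (fun e => by rw [hfx, hdx, hγ])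
    (fun e => by simp [outDeriv])
    (fun e => by
      rw [hfx, ← (hrep e).total_snd (G.len_pos e)]
      simp [outDeriv]) hψ
  rw [form, hg, inner_trace hh hx hψ,
    sum_vertex_eq hv.robin hv.kirchhoff ψ]
  ring

/-- A function orthogonal to all mean-zero functions is constant. -/
lemma eq_smul_one_of_orthogonal {ℓ : ℝ} (hℓ : 0 < ℓ) {g : EdgeL2 ℓ}
    (h : ∀ γ, total hℓ γ = 0 → ⟪g, γ⟫_ℂ = 0) : ∃ d : ℂ, g = d • one hℓ := by
  have : g ∈ (Submodule.span ℂ {one hℓ})ᗮᗮ := by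
    rw [Submodule.mem_orthogonal']
    intro γ hγ
    refine h γ ?_
    rw [total_eq_inner]
    exact Submodule.mem_orthogonal_singleton_iff_inner_right.1 hγ
  rw [Submodule.orthogonal_orthogonal, Submodule.mem_span_singleton] at this
  obtain ⟨d, hd⟩ := this
  exact ⟨d, hd.symm⟩

omit [DecidableEq V] in
-- The lemma of du Bois-Reymond: test with functions supported on the single edge `e` and vanishing
-- at its ends, that is, with primitives of mean-zero `γ`. The derivative then differs from the
-- primitive of `-μ f` by something orthogonal to every such `γ`, hence by a constant.
lemma exists_derivOn_eq_of_weak {VR : Finset V} {h : V → E × Bool}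
    {t μ : ℝ} {x : G.sobolev}
    (hx : x ∈ weakEigenspace G.sobolevIncl (G.trace VR h) t (μ + 1)) (e : E) :
    ∃ d : ℂ, G.derivOn e x = d • one (G.len_pos e) +
      volterra (G.len_pos e) (-((μ : ℂ) • G.funOn e x)) := by
  classical
  have hℓ := G.len_pos e
  obtain ⟨d, hd⟩ := eq_smul_one_of_orthogonal hℓ
    (g := G.derivOn e x - volterra hℓ (-((μ : ℂ) • G.funOn e x))) (by
    intro γ hγ
    obtain ⟨Γ, hΓe, hΓne⟩ : ∃ Γ : G.L2, Γ e = γ ∧ ∀ e', e' ≠ e → Γ e' = 0 :=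
      ⟨WithLp.toLp 2 (Pi.single e γ : ∀ e, EdgeL2 (G.len e)),
        Pi.single_eq_same (M := fun e => EdgeL2 (G.len e)) e γ, fun e' he =>
        Pi.single_eq_of_ne (M := fun e => EdgeL2 (G.len e)) he γ⟩
    have h0 : ∀ e', (0 : E → ℂ) e' = (0 : V → ℂ) (G.vert e' false) := fun _ => rfl
    have h1 : ∀ e', (0 : E → ℂ) e' + total (G.len_pos e') (Γ e')
        = (0 : V → ℂ) (G.vert e' true) := by
      intro e'
      by_cases he : e' = e
      · subst he; rw [hΓe, hγ]; simp
      · rw [hΓne e' he]; simp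
    obtain ⟨y, hdy, hfy', hy0⟩ := exists_sobolev h0 h1
    have hy := hx y
    obtain ⟨φ, hφ⟩ := exists_vertexValue x
    have hT : G.trace VR h y = 0 := by
      refine PiLp.ext fun v => ?_
      rw [trace_apply]
      exact hy0 _ _
    have hfy : ∀ e', G.funOn e' y = volterra (G.len_pos e') (Γ e') := fun e' => by
      rw [hfy']; simp
    have hs1 : ∑ e', ⟪G.derivOn e' x, G.derivOn e' y⟫_ℂ = ⟪G.derivOn e x, γ⟫_ℂ := by
      rw [Finset.sum_eq_single e, hdy, hΓe]
      · intro e' _ he; rw [hdy, hΓne e' he, inner_zero_right]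
      · simp
    have hs2 : ⟪G.sobolevIncl x, G.sobolevIncl y⟫_ℂ = ⟪G.funOn e x, volterra hℓ γ⟫_ℂ := by
      rw [inner_sobolevIncl, Finset.sum_eq_single e, hfy, hΓe]
      · intro e' _ he; rw [hfy, hΓne e' he, map_zero, inner_zero_right]
      · simp
    rw [form, hT, inner_zero_right, mul_zero, add_zero, inner_sobolev, hs1, hs2] at hy
    have hV := inner_volterra hℓ (-((μ : ℂ) • G.funOn e x)) γ
    rw [hγ, mul_zero, inner_neg_left, inner_smul_left, Complex.conj_ofReal] at hV
    push_cast at hy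
    rw [inner_sub_left]
    linear_combination hy - hV)
  exact ⟨d, by rw [← hd]; abel⟩

/-- Weak eigenfunctions satisfy the differential equation and the vertex conditions. -/
lemma strong_of_weak [Finite V] {VR : Finset V} {h : V → E × Bool}
    (hh : ∀ v ∈ VR, G.vert (h v).1 (h v).2 = v) {t μ : ℝ} {x : G.sobolev}
    (hx : x ∈ weakEigenspace G.sobolevIncl (G.trace VR h) t (μ + 1)) :
    ∃ (u u' : E → ℝ → ℂ) (φ : V → ℂ),
      (∀ e, IsSobolevRep (G.len e) (G.sobolevIncl x e) (-((μ : ℂ) • G.sobolevIncl x e))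
        (u e) (u' e)) ∧
      G.VertexConditions VR t u u' φ ∧ ∀ e b, G.endVal e b x = φ (G.vert e b) := by
  have := Fintype.ofFinite V
  choose d hd using exists_derivOn_eq_of_weak hx
  obtain ⟨φ, hφ⟩ := exists_vertexValue x
  set u : E → ℝ → ℂ := fun e s => G.startVal e x + ∫ r in (0 : ℝ)..s, G.derivOn e x r with hu
  set u' : E → ℝ → ℂ := fun e s =>
    d e + ∫ r in (0 : ℝ)..s, (-((μ : ℂ) • G.funOn e x) : EdgeL2 (G.len e)) r with hu'
  have hgu : ∀ e, G.derivOn e x =ᵐ[volume.restrict (Set.Icc 0 (G.len e))] u' e := by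
    intro e
    rw [hd e]
    exact coeFn_const_add_volterra _ _ _
  have hrep : ∀ e, IsSobolevRep (G.len e) (G.sobolevIncl x e) (-((μ : ℂ) • G.sobolevIncl x e))
      (u e) (u' e) := by
    intro e
    refine ⟨coeFn_funOn x e, fun s hs => ?_, fun s hs => ?_⟩
    · rw [← integral_congr_Icc (hgu e) hs]; simp [hu]
    · simp only [hu', sobolevIncl_apply, intervalIntegral.integral_same, add_zero]
  set a : E × Bool → ℂ := fun p => G.outDeriv u' p.1 p.2 with ha
  have ha0 : ∀ e, a (e, false) = d e := fun e => by simp [ha, outDeriv, hu']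
  have ha1 : ∀ e, a (e, true) = -(d e + total (G.len_pos e) (-((μ : ℂ) • G.funOn e x))) := by
    intro e
    rw [total_apply]; simp [ha, outDeriv, hu']
  have key : ∀ ψ : V → ℂ, ∑ v, starRingEnd ℂ (∑ h ∈ G.halfEdges v, a h) * ψ v
      = t * ∑ v ∈ VR, starRingEnd ℂ (φ v) * ψ v := by
    intro ψ
    -- Edgewise affine functions realise arbitrary vertex values `ψ`; with the differential equation
    -- known, testing against them leaves only the vertex terms.
    obtain ⟨Γ, hΓ⟩ : ∃ Γ : G.L2, ∀ e, Γ e =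
        ((ψ (G.vert e true) - ψ (G.vert e false)) / (G.len e : ℂ)) • one (G.len_pos e) :=
      ⟨WithLp.toLp 2 fun e =>
        ((ψ (G.vert e true) - ψ (G.vert e false)) / (G.len e : ℂ)) • one (G.len_pos e),
        fun _ => rfl⟩
    have h0 : ∀ e, (fun e => ψ (G.vert e false)) e = ψ (G.vert e false) := fun _ => rfl
    have h1 : ∀ e, (fun e => ψ (G.vert e false)) e + total (G.len_pos e) (Γ e)
        = ψ (G.vert e true) := by
      intro e
      have hne : (G.len e : ℂ) ≠ 0 := by exact_mod_cast (G.len_pos e).ne'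
      rw [hΓ, map_smul, total_one, smul_eq_mul, div_mul_cancel₀ _ hne]
      ring
    obtain ⟨y, -, -, hy⟩ := exists_sobolev h0 h1
    have hw := hx y
    rw [form, inner_trace hh hφ hy, green hd ha0 ha1 hy] at hw
    linear_combination -hw
  have hvert : ∀ w, starRingEnd ℂ (∑ h ∈ G.halfEdges w, a h)
      = t * if w ∈ VR then starRingEnd ℂ (φ w) else 0 := by
    intro w
    have := key (fun v => if v = w then 1 else 0)
    simpa using this
  refine ⟨u, u', φ, hrep, ⟨fun e b => ?_, fun v hv => ?_, fun v hv => ?_⟩, hφ⟩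
  · rw [← hφ]
    cases b
    · simp [endVal_false, endCoord, hu]
    · rw [endVal_true, total_apply]; simp [endCoord, hu]
  · have := congrArg (starRingEnd ℂ) (hvert v)
    rw [Complex.conj_conj, if_pos hv, map_mul, Complex.conj_ofReal, Complex.conj_conj] at this
    exact this
  · have := congrArg (starRingEnd ℂ) (hvert v)
    rw [Complex.conj_conj, if_neg hv, mul_zero, map_zero] at this
    exact this

variable (G) in
/-- The `x` such that there are `n` independent weak eigenfunctions with eigenvalue at most `x`. -/
abbrev weakCountSet (VR : Finset V) (h : V → E × Bool) (n : ℕ) (t : ℝ) : Set ℝ :=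
  countSet (X := G.sobolev) (H := G.L2) (F := EuclideanSpace ℂ VR) G.sobolevIncl (G.trace VR h) n t

/-- The eigenvalues of the Robin Laplacian are given by the abstract spectral problem. -/
lemma robinEigenvalue_set_eq [Finite V] {VR : Finset V} {h : V → E × Bool}
    (hh : ∀ v ∈ VR, G.vert (h v).1 (h v).2 = v) (n : ℕ) (t : ℝ) :
    {x : ℝ | ∃ f : Fin n → G.L2, LinearIndependent ℂ f ∧
      ∀ i, ∃ μ ≤ x, G.InEigenspace VR t μ (f i)}
      = {x | x + 1 ∈ G.weakCountSet VR h n t} := by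
  ext x
  constructor
  · rintro ⟨f, hf, hm⟩
    choose μ hμ hE using hm
    choose g hg hgf using fun i => exists_weak_of_inEigenspace hh (hE i)
    refine ⟨g, ?_, fun i => ⟨μ i + 1, by linarith [hμ i], hg i⟩⟩
    have : f = G.sobolevIncl.toLinearMap ∘ g := funext fun i => (hgf i).symm
    rw [this] at hf
    exact hf.of_comp
  · rintro ⟨g, hg, hm⟩
    refine ⟨fun i => G.sobolevIncl (g i), ?_, fun i => ?_⟩
    · exact hg.map' G.sobolevIncl.toLinearMap (LinearMap.ker_eq_bot.2 sobolevIncl_injective)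
    · obtain ⟨ν, hν, hmem⟩ := hm i
      refine ⟨ν - 1, by linarith, ?_⟩
      rw [← sub_add_cancel ν 1] at hmem
      obtain ⟨u, u', φ, h1, h2, -⟩ := strong_of_weak hh hmem
      exact inEigenspace_iff.2 ⟨u, u', φ, h1, h2⟩

/-- The shift by `1` is the extra `‖f‖²` in the `H¹` norm. Nonemptiness is needed because the real
infimum of the empty set has the default value `0`. -/
lemma robinEigenvalue_eq [Finite V] {VR : Finset V} {h : V → E × Bool}
    (hh : ∀ v ∈ VR, G.vert (h v).1 (h v).2 = v) {n : ℕ} (hn : 1 ≤ n) {t : ℝ} (ht : 0 ≤ t)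
    (hne : (G.weakCountSet VR h n t).Nonempty) :
    G.robinEigenvalue VR n t = sInf (G.weakCountSet VR h n t) - 1 := by
  unfold robinEigenvalue
  rw [robinEigenvalue_set_eq hh]
  have hmin : sInf (G.weakCountSet VR h n t) ∈ G.weakCountSet VR h n t := by
    apply sInf_mem_countSet
    · exact G.isCompactOperator_sobolevIncl
    · exact ht
    · exact hne
  refine IsLeast.csInf_eq ⟨?_, fun x hx => ?_⟩
  · change sInf (G.weakCountSet VR h n t) - 1 + 1 ∈ G.weakCountSet VR h n t
    rwa [sub_add_cancel]
  · have := csInf_le (bddBelow_countSet hn ht) hx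
    linarith

end MetricGraph

/-! ### The amplitude identity and the star estimate for vertex values. -/

namespace MetricGraph

open IntervalL2 FormSpectrum
open scoped InnerProductSpace

lemma hasDerivAt_of_eq_integral {ℓ : ℝ} {U w : ℝ → ℂ} (hw : ContinuousOn w (Set.Icc 0 ℓ))
    (hU : ∀ x ∈ Set.Icc 0 ℓ, U x = U 0 + ∫ t in (0 : ℝ)..x, w t) {x : ℝ}
    (hx : x ∈ Set.Ioo 0 ℓ) : HasDerivAt U (w x) x := by
  have h1 : HasDerivAt (fun x => U 0 + ∫ t in (0 : ℝ)..x, w t) (w x) x := by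
    refine (intervalIntegral.integral_hasDerivAt_right ?_ ?_ ?_).const_add _
    · refine (hw.mono ?_).intervalIntegrable
      rw [Set.uIcc_of_le hx.1.le]
      exact Set.Icc_subset_Icc_right hx.2.le
    · exact (hw.mono Set.Ioo_subset_Icc_self).stronglyMeasurableAtFilter isOpen_Ioo x hx
    · exact hw.continuousAt (Icc_mem_nhds hx.1 hx.2)
  refine h1.congr_of_eventuallyEq ?_
  filter_upwards [Ioo_mem_nhds hx.1 hx.2] with y hy
  exact hU y ⟨hy.1.le, hy.2.le⟩

lemma norm_sq_eq_integral {ℓ : ℝ} (hℓ : 0 < ℓ) {f : EdgeL2 ℓ} {u : ℝ → ℂ}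
    (hf : f =ᵐ[volume.restrict (Set.Icc 0 ℓ)] u) :
    ‖f‖ ^ 2 = ∫ x in (0 : ℝ)..ℓ, ‖u x‖ ^ 2 := by
  have h := inner_eq_integral hℓ hf hf
  have h2 : ∀ x, starRingEnd ℂ (u x) * u x = ((‖u x‖ ^ 2 : ℝ) : ℂ) := fun x => by
    rw [Complex.conj_mul']; push_cast; rfl
  simp only [h2] at h
  rw [intervalIntegral.integral_ofReal, inner_self_eq_ofReal] at h
  exact_mod_cast h

/-- On an edge, an eigenfunction has constant amplitude `|u'|² + μ |u|²`, and its norm is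
expressed through the amplitude and the boundary values. -/
lemma IsSobolevRep.amplitude {ℓ : ℝ} (hℓ : 0 < ℓ) {μ : ℝ} {f : EdgeL2 ℓ} {u u' : ℝ → ℂ}
    (h : IsSobolevRep ℓ f (-((μ : ℂ) • f)) u u') :
    ‖u' ℓ‖ ^ 2 + μ * ‖u ℓ‖ ^ 2 = ‖u' 0‖ ^ 2 + μ * ‖u 0‖ ^ 2 ∧
    2 * μ * ‖f‖ ^ 2 = (‖u' 0‖ ^ 2 + μ * ‖u 0‖ ^ 2) * ℓ + ⟪u 0, u' 0⟫_ℝ - ⟪u ℓ, u' ℓ⟫_ℝ := by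
  have hcu := h.continuousOn_fst hℓ.le
  have hcu' := h.continuousOn_snd hℓ.le
  have hg : (-((μ : ℂ) • f) : EdgeL2 ℓ) =ᵐ[volume.restrict (Set.Icc 0 ℓ)]
      fun x => -((μ : ℂ) * u x) := by
    filter_upwards [Lp.coeFn_neg ((μ : ℂ) • f), Lp.coeFn_smul (μ : ℂ) f, h.rep] with x h1 h2 h3
    rw [h1, Pi.neg_apply, h2, Pi.smul_apply, h3, smul_eq_mul]
  have hd : ∀ x ∈ Set.Ioo 0 ℓ, HasDerivAt u (u' x) x := fun x hx =>
    hasDerivAt_of_eq_integral hcu' h.integral_fst hx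
  have hd' : ∀ x ∈ Set.Ioo 0 ℓ, HasDerivAt u' (-((μ : ℂ) * u x)) x := fun x hx =>
    hasDerivAt_of_eq_integral (w := fun x => -((μ : ℂ) * u x))
      (continuousOn_const.mul hcu).neg
      (fun y hy => by rw [h.integral_snd y hy, integral_congr_edge hg hy]) hx
  have hinner : ∀ a b : ℂ, ⟪a, -((μ : ℂ) * b)⟫_ℝ = -(μ * ⟪a, b⟫_ℝ) := by
    intro a b
    rw [inner_neg_right, ← Complex.real_smul, real_inner_smul_right]
  -- The derivative is `2⟨u', -μ u⟩ + 2μ⟨u, u'⟩ = 0`.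
  have hconst : ∀ x ∈ Set.Icc 0 ℓ,
      ‖u' x‖ ^ 2 + μ * ‖u x‖ ^ 2 = ‖u' 0‖ ^ 2 + μ * ‖u 0‖ ^ 2 := by
    intro x hx
    have hsub : Set.Icc 0 x ⊆ Set.Icc 0 ℓ := Set.Icc_subset_Icc_right hx.2
    have := intervalIntegral.integral_eq_sub_of_hasDerivAt_of_le hx.1
      (f := fun x => ‖u' x‖ ^ 2 + μ * ‖u x‖ ^ 2) (f' := fun _ => 0)
      (((hcu'.mono hsub).norm.pow 2).add (continuousOn_const.mul ((hcu.mono hsub).norm.pow 2)))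
      (fun y hy => by
        have hy' : y ∈ Set.Ioo 0 ℓ := ⟨hy.1, hy.2.trans_le hx.2⟩
        convert! (hd' y hy').norm_sq.add (((hd y hy').norm_sq).const_mul μ) using 1
        rw [hinner, real_inner_comm (u y)]; ring) (by simp)
    rw [intervalIntegral.integral_zero] at this
    linarith
  refine ⟨hconst ℓ ⟨hℓ.le, le_rfl⟩, ?_⟩
  set A := ‖u' 0‖ ^ 2 + μ * ‖u 0‖ ^ 2
  have hint : IntervalIntegrable (fun x => ‖u x‖ ^ 2) volume 0 ℓ := by
    apply ContinuousOn.intervalIntegrable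
    rw [Set.uIcc_of_le hℓ.le]
    exact hcu.norm.pow 2
  -- Here `⟨u, u'⟩' = |u'|² - μ |u|²`, and the constant amplitude `A` eliminates `|u'|²`.
  have hftc := intervalIntegral.integral_eq_sub_of_hasDerivAt_of_le hℓ.le
    (f := fun x => ⟪u x, u' x⟫_ℝ) (f' := fun x => A - 2 * μ * ‖u x‖ ^ 2)
    (hcu.inner hcu')
    (fun y hy => by
      convert! (hd y hy).inner ℝ (hd' y hy) using 1
      rw [hinner, real_inner_self_eq_norm_sq, real_inner_self_eq_norm_sq,
        ← hconst y ⟨hy.1.le, hy.2.le⟩]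
      ring)
    (intervalIntegrable_const.sub (hint.const_mul _))
  rw [intervalIntegral.integral_sub intervalIntegrable_const (hint.const_mul _),
    intervalIntegral.integral_const_mul, intervalIntegral.integral_const,
    ← norm_sq_eq_integral hℓ h.rep, sub_zero, smul_eq_mul] at hftc
  linarith

variable {V E : Type*} [Fintype E] {G : MetricGraph V E} [DecidableEq V]

omit [Fintype E] [DecidableEq V] in
lemma StarDecomposition.armLength_nonneg (D : G.StarDecomposition) (e : E) (b : Bool) :
    0 ≤ D.armLength e b := by
  have h := D.cut_mem e
  cases b
  · simpa [armLength] using h.1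
  · simpa [armLength] using h.2

lemma StarDecomposition.starLength_nonneg (D : G.StarDecomposition) (v : V) :
    0 ≤ D.starLength v :=
  Finset.sum_nonneg fun h _ => D.armLength_nonneg h.1 h.2

lemma StarDecomposition.starHarmonic_nonneg (D : G.StarDecomposition) (v : V) :
    0 ≤ D.starHarmonic v := by
  unfold starHarmonic
  split_ifs
  · exact le_rfl
  · exact one_div_nonneg.2 (Finset.sum_nonneg fun h _ => inv_nonneg.2 (D.armLength_nonneg h.1 h.2))

/-- Cauchy–Schwarz with weights `s⁻¹` and `s`. A vanishing arm would make `s⁻¹` useless, but then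
`starHarmonic` is `0` and only nonnegativity remains to be checked. -/
lemma StarDecomposition.starHarmonic_mul_le (D : G.StarDecomposition) (v : V)
    (a : E × Bool → ℂ) :
    D.starHarmonic v * ‖∑ h ∈ G.halfEdges v, a h‖ ^ 2
      ≤ ∑ h ∈ G.halfEdges v, D.armLength h.1 h.2 * ‖a h‖ ^ 2 := by
  have hY : 0 ≤ ∑ h ∈ G.halfEdges v, D.armLength h.1 h.2 * ‖a h‖ ^ 2 :=
    Finset.sum_nonneg fun h _ => mul_nonneg (D.armLength_nonneg h.1 h.2) (sq_nonneg _)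
  unfold starHarmonic
  split_ifs with h0
  · rw [zero_mul]; exact hY
  · push Not at h0
    set X := ∑ h ∈ G.halfEdges v, (D.armLength h.1 h.2)⁻¹
    have hX : 0 ≤ X := Finset.sum_nonneg fun h _ => inv_nonneg.2 (D.armLength_nonneg h.1 h.2)
    have hcs : (∑ h ∈ G.halfEdges v, ‖a h‖) ^ 2
        ≤ X * ∑ h ∈ G.halfEdges v, D.armLength h.1 h.2 * ‖a h‖ ^ 2 := by
      refine Finset.sum_sq_le_sum_mul_sum_of_sq_le_mul _
        (fun h _ => inv_nonneg.2 (D.armLength_nonneg h.1 h.2))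
        (fun h _ => mul_nonneg (D.armLength_nonneg h.1 h.2) (sq_nonneg _)) fun h hh => ?_
      rw [inv_mul_cancel_left₀ (h0 h hh)]
    have hle : ‖∑ h ∈ G.halfEdges v, a h‖ ^ 2
        ≤ X * ∑ h ∈ G.halfEdges v, D.armLength h.1 h.2 * ‖a h‖ ^ 2 :=
      le_trans (by gcongr; exact norm_sum_le _ _) hcs
    rcases hX.eq_or_lt with h | h
    · rw [← h]; simpa using hY
    · rw [one_div, inv_mul_le_iff₀ h]; exact hle

/-- The vertex values of an eigenfunction are controlled through a star decomposition. -/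
lemma StarDecomposition.sum_vertexValue_le [Finite V] (D : G.StarDecomposition) {VR : Finset V}
    {t μ : ℝ} (hμ : 0 ≤ μ) {f : G.L2} {u u' : E → ℝ → ℂ} {φ : V → ℂ}
    (hrep : ∀ e, IsSobolevRep (G.len e) (f e) (-((μ : ℂ) • f e)) (u e) (u' e))
    (hv : G.VertexConditions VR t u u' φ) :
    ∑ v ∈ VR, (μ * D.starLength v + t ^ 2 * D.starHarmonic v + t) * ‖φ v‖ ^ 2
      ≤ 2 * μ * ‖f‖ ^ 2 := by
  have := Fintype.ofFinite V
  set a : E × Bool → ℂ := fun p => G.outDeriv u' p.1 p.2 with ha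
  have hcont0 : ∀ e, u e 0 = φ (G.vert e false) := fun e => by
    simpa [endCoord] using hv.cont e false
  have hcont1 : ∀ e, u e (G.len e) = φ (G.vert e true) := fun e => by
    simpa [endCoord] using hv.cont e true
  -- `P` is the share of a half-edge in `2 μ ‖f‖²`: the arm length times the amplitude, read off at
  -- that end, plus the boundary term there. The two arms add up to the edge, whatever the cut
  -- point.
  set P : E × Bool → ℝ := fun p =>
    D.armLength p.1 p.2 * (‖a p‖ ^ 2 + μ * ‖φ (G.vert p.1 p.2)‖ ^ 2)
      + ⟪φ (G.vert p.1 p.2), a p⟫_ℝ with hP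
  have hedge : ∀ e, 2 * μ * ‖f e‖ ^ 2 = P (e, false) + P (e, true) := by
    intro e
    obtain ⟨h1, h2⟩ := (hrep e).amplitude (G.len_pos e)
    have h3 : ‖a (e, true)‖ = ‖u' e (G.len e)‖ := by simp [ha, outDeriv]
    have h4 : a (e, false) = u' e 0 := by simp [ha, outDeriv]
    have h5 : a (e, true) = -u' e (G.len e) := by simp [ha, outDeriv]
    have h6 : D.armLength e false + D.armLength e true = G.len e := by simp [armLength]
    simp only [hP, h3]
    rw [h4, h5, ← hcont0, ← hcont1, h1, h2, ← h6, inner_neg_right]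
    ring
  have hnorm : 2 * μ * ‖f‖ ^ 2 = ∑ v, ∑ h ∈ G.halfEdges v, P h := by
    rw [sum_halfEdges, PiLp.norm_sq_eq_of_L2, Finset.mul_sum]
    exact Finset.sum_congr rfl fun e _ => hedge e
  have hvert : ∀ v, ∑ h ∈ G.halfEdges v, P h
      = ∑ h ∈ G.halfEdges v, D.armLength h.1 h.2 * ‖a h‖ ^ 2
        + μ * D.starLength v * ‖φ v‖ ^ 2 + ⟪φ v, ∑ h ∈ G.halfEdges v, a h⟫_ℝ := by
    intro v
    rw [inner_sum, starLength, Finset.mul_sum, Finset.sum_mul, ← Finset.sum_add_distrib,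
      ← Finset.sum_add_distrib]
    refine Finset.sum_congr rfl fun h hh => ?_
    have : G.vert h.1 h.2 = v := (Finset.mem_filter.1 hh).2
    simp only [hP, this]
    ring
  have hpos : ∀ v, 0 ≤ ∑ h ∈ G.halfEdges v, D.armLength h.1 h.2 * ‖a h‖ ^ 2 := fun v =>
    Finset.sum_nonneg fun h _ => mul_nonneg (D.armLength_nonneg h.1 h.2) (sq_nonneg _)
  rw [hnorm]
  refine (Finset.sum_le_sum (g := fun v => ∑ h ∈ G.halfEdges v, P h) fun v hvR => ?_).trans
    (Finset.sum_le_sum_of_subset_of_nonneg (Finset.subset_univ VR) fun v _ hvR => ?_)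
  · have hr : ∑ h ∈ G.halfEdges v, a h = t * φ v := hv.robin v hvR
    have h1 := D.starHarmonic_mul_le v a
    have h2 : ⟪φ v, (t : ℂ) * φ v⟫_ℝ = t * ‖φ v‖ ^ 2 := by
      rw [← Complex.real_smul, real_inner_smul_right, real_inner_self_eq_norm_sq]
    have h3 : ‖(t : ℂ) * φ v‖ ^ 2 = t ^ 2 * ‖φ v‖ ^ 2 := by
      rw [norm_mul, mul_pow, Complex.norm_real, Real.norm_eq_abs, sq_abs]
    simp only [hvert v, hr, h2] at h1 ⊢
    rw [h3] at h1
    linarith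
  · have hk : ∑ h ∈ G.halfEdges v, a h = 0 := hv.kirchhoff v hvR
    rw [hvert v, hk, inner_zero_right, add_zero]
    exact add_nonneg (hpos v)
      (mul_nonneg (mul_nonneg hμ (D.starLength_nonneg v)) (sq_nonneg _))

/-- Maximising the inverse minimises the denominator, so the lower bounds `S` and `s` assumed at the
extremal vertex `v` pass to the combined coefficient at every other `w`, though not to the star
length and harmonic term of `w` separately. -/
lemma StarDecomposition.le_of_sensitivityTerm_le (D : G.StarDecomposition) {t μ s S : ℝ}
    (hμ : 0 < μ) (ht : 0 ≤ t) (hS : 0 < S) {v w : V}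
    (hSv : S ≤ D.starLength v) (hsv : s ≤ D.starHarmonic v)
    (hle : D.sensitivityTerm t μ w ≤ D.sensitivityTerm t μ v) :
    μ * S + t ^ 2 * s + t ≤ μ * D.starLength w + t ^ 2 * D.starHarmonic w + t := by
  unfold sensitivityTerm at hle
  rw [ENNReal.inv_le_inv, ENNReal.ofReal_le_ofReal_iff'] at hle
  have h0 : 0 ≤ (t ^ 2 * D.starHarmonic v + t) / μ := by
    have := D.starHarmonic_nonneg v
    positivity
  have h1 : D.starLength v + (t ^ 2 * D.starHarmonic v + t) / μ
      ≤ D.starLength w + (t ^ 2 * D.starHarmonic w + t) / μ := by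
    -- `ENNReal.ofReal` truncates at `0`, hence a second case; it is excluded because the
    -- denominator at `v` is at least `S > 0`.
    rcases hle with h | h
    · exact h
    · linarith
  have h2 := mul_le_mul_of_nonneg_left h1 hμ.le
  rw [mul_add, mul_add, mul_div_cancel₀ _ hμ.ne', mul_div_cancel₀ _ hμ.ne'] at h2
  have h3 : t ^ 2 * s ≤ t ^ 2 * D.starHarmonic v := by gcongr
  have h4 : μ * S ≤ μ * D.starLength v := by gcongr
  linarith

lemma norm_sq_trace_le [Finite V] {VR : Finset V} {h : V → E × Bool}
    (hh : ∀ v ∈ VR, G.vert (h v).1 (h v).2 = v) (D : G.StarDecomposition) {t μ s S : ℝ}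
    (hμ : 0 < μ) (ht : 0 ≤ t) (hs : 0 < s) (hS : 0 < S)
    (hle : ∀ w ∈ VR, μ * S + t ^ 2 * s + t
      ≤ μ * D.starLength w + t ^ 2 * D.starHarmonic w + t)
    {x : G.sobolev}
    (hx : x ∈ weakEigenspace G.sobolevIncl (G.trace VR h) t (μ + 1)) :
    ‖G.trace VR h x‖ ^ 2 ≤ 2 * μ / (μ * S + t ^ 2 * s + t) * ‖G.sobolevIncl x‖ ^ 2 := by
  obtain ⟨u, u', φ, hrep, hvc, hφ⟩ := strong_of_weak hh hx
  have h1 := D.sum_vertexValue_le hμ.le hrep hvc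
  have hpos : 0 < μ * S + t ^ 2 * s + t := by positivity
  rw [norm_sq_trace hh hφ, div_mul_eq_mul_div, le_div_iff₀ hpos, Finset.sum_mul]
  refine le_trans (Finset.sum_le_sum fun v hv => ?_) h1
  rw [mul_comm]
  exact mul_le_mul_of_nonneg_right (hle v hv) (sq_nonneg _)

lemma continuousOn_robinEigenvalue_and_mono [Finite V] {VR : Finset V} {h : V → E × Bool}
    (hh : ∀ v ∈ VR, G.vert (h v).1 (h v).2 = v) {n : ℕ} (hn : 1 ≤ n)
    (hne : (G.weakCountSet VR h n 0).Nonempty) (σ : ℝ) :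
    ContinuousOn (G.robinEigenvalue VR n) (Set.Icc 0 σ) ∧
      MonotoneOn (G.robinEigenvalue VR n) (Set.Icc 0 σ) := by
  have hJ := G.isCompactOperator_sobolevIncl
  have hne' : ∀ t, 0 ≤ t → (G.weakCountSet VR h n t).Nonempty := fun t ht => by
    apply countSet_nonempty
    · exact hJ
    · exact hn
    · exact hne
    · exact ht
  have heq : ∀ t, 0 ≤ t →
      G.robinEigenvalue VR n t = sInf (G.weakCountSet VR h n t) - 1 := fun t ht =>
    robinEigenvalue_eq hh hn ht (hne' t ht)
  constructor
  · have hc : ContinuousOn (fun t => sInf (G.weakCountSet VR h n t)) (Set.Icc 0 σ) := by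
      apply continuousOn_sInf_countSet
      · exact hJ
      · exact hn
      · exact hne
    exact (hc.sub continuousOn_const).congr fun t ht => heq t ht.1
  · intro a ha b hb hab
    have hm : sInf (G.weakCountSet VR h n a) ≤ sInf (G.weakCountSet VR h n b) := by
      apply sInf_countSet_mono
      · exact hJ
      · exact hn
      · exact hne
      · exact ha.1
      · exact hab
    rw [heq a ha.1, heq b hb.1]
    linarith

lemma eventually_robinEigenvalue_le [Finite V] {VR : Finset V} {h : V → E × Bool}
    (hh : ∀ v ∈ VR, G.vert (h v).1 (h v).2 = v) {n : ℕ} (hn : 1 ≤ n)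
    (hne : (G.weakCountSet VR h n 0).Nonempty) {t : ℝ} (ht : 0 ≤ t) {r r' : ℝ} (hr : 0 ≤ r)
    (hrr' : r < r')
    (hbound : ∀ x ∈ weakEigenspace G.sobolevIncl (G.trace VR h) t (G.robinEigenvalue VR n t + 1),
      ‖G.trace VR h x‖ ^ 2 ≤ r * ‖G.sobolevIncl x‖ ^ 2) :
    ∀ᶠ y in nhdsWithin t (Set.Ioi t),
      G.robinEigenvalue VR n y ≤ G.robinEigenvalue VR n t + (y - t) * r' := by
  have hJ := G.isCompactOperator_sobolevIncl
  have heq : ∀ t, 0 ≤ t →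
      G.robinEigenvalue VR n t = sInf (G.weakCountSet VR h n t) - 1 := fun t ht =>
    robinEigenvalue_eq hh hn ht (by
      apply countSet_nonempty
      · exact hJ
      · exact hn
      · exact hne
      · exact ht)
  have hev : ∀ᶠ y in nhdsWithin t (Set.Ioi t),
      sInf (G.weakCountSet VR h n y) ≤ sInf (G.weakCountSet VR h n t) + (y - t) * r' := by
    apply eventually_sInf_countSet_le
    · exact hJ
    · exact hn
    · exact hne
    · exact ht
    · exact hr
    · exact hrr'
    · have h1 := heq t ht
      rw [eq_sub_iff_add_eq] at h1
      rw [h1] at hbound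
      exact hbound
  filter_upwards [hev, self_mem_nhdsWithin] with y hy hyt
  rw [heq t ht, heq y (ht.trans (le_of_lt hyt))]
  linarith

end MetricGraph

/-! ### The gap estimate. -/

theorem proposition7p2 {V E : Type*} [Finite V] [DecidableEq V] [Fintype E]
    (G : MetricGraph V E) (VR : Finset V) (n : ℕ) (hn : 1 ≤ n) (σ : ℝ) (hσ : 0 < σ)
    -- for every `t ∈ [0, σ]` a star decomposition and a vertex `v t ∈ VR` attaining the maximum
    (D : ℝ → G.StarDecomposition) (v : ℝ → V)
    (hv : ∀ t ∈ Set.Icc 0 σ, v t ∈ VR ∧ ∀ w ∈ VR,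
      (D t).sensitivityTerm t (G.robinEigenvalue VR n t) w ≤
        (D t).sensitivityTerm t (G.robinEigenvalue VR n t) (v t))
    (s S : ℝ) (hs : 0 < s) (hS : 0 < S)
    (hSv : ∀ t ∈ Set.Icc 0 σ, S ≤ (D t).starLength (v t))
    (hsv : ∀ t ∈ Set.Icc 0 σ, s ≤ (D t).starHarmonic (v t))
    (hlam : 1 / (4 * s * S) < G.robinEigenvalue VR n 0)
    (α : ℝ) (hα : α = 2 / √(4 * G.robinEigenvalue VR n 0 * s * S - 1)) :
    G.robinNeumannGap VR n σ <
      (Real.exp (2 * α * Real.arctan (α / 2 * (1 + 2 * s * σ))) /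
          Real.exp (2 * α * Real.arctan (α / 2)) - 1) * G.robinEigenvalue VR n 0 := by
  classical
  have h0mem : (0 : ℝ) ∈ Set.Icc 0 σ := ⟨le_rfl, hσ.le⟩
  have hlam0 : 0 < G.robinEigenvalue VR n 0 := lt_trans (by positivity) hlam
  -- no vertex of `VR` is isolated
  have hiso : ∀ w ∈ VR, ∃ p : E × Bool, G.vert p.1 p.2 = w := by
    intro w hw
    -- At `t = 0` the extremal vertex has the shortest star among those in `VR`, so every such star
    -- has length at least `S > 0` and contains a half-edge. The trace map needs one at each vertex
    -- of `VR` to read off the value there.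
    have h1 := (D 0).le_of_sensitivityTerm_le hlam0 le_rfl hS (hSv 0 h0mem) (hsv 0 h0mem)
      ((hv 0 h0mem).2 w hw)
    have h2 : 0 < (D 0).starLength w := by
      have : 0 < G.robinEigenvalue VR n 0 * S := mul_pos hlam0 hS
      by_contra! h
      nlinarith
    obtain ⟨p, hp⟩ := Finset.nonempty_of_sum_ne_zero h2.ne'
    exact ⟨p, (Finset.mem_filter.1 hp).2⟩
  obtain ⟨p₀, -⟩ := hiso (v 0) (hv 0 h0mem).1
  obtain ⟨h, hh⟩ : ∃ h : V → E × Bool, ∀ w ∈ VR, G.vert (h w).1 (h w).2 = w := by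
    refine ⟨fun w => if hw : w ∈ VR then (hiso w hw).choose else p₀, fun w hw => ?_⟩
    dsimp only
    rw [dif_pos hw]
    exact (hiso w hw).choose_spec
  have hne : (G.weakCountSet VR h n 0).Nonempty := by
    -- With fewer than `n` independent eigenfunctions, `robinEigenvalue` would be the infimum of the
    -- empty set, namely `0`, against its positivity.
    by_contra hemp
    rw [Set.not_nonempty_iff_eq_empty] at hemp
    have : G.robinEigenvalue VR n 0 = 0 := by
      unfold MetricGraph.robinEigenvalue
      rw [MetricGraph.robinEigenvalue_set_eq hh, hemp]
      simp
    exact hlam0.ne' this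
  obtain ⟨hcont, hmono⟩ := MetricGraph.continuousOn_robinEigenvalue_and_mono hh hn hne σ
  refine DiniComparison.sub_lt_of_dini hσ hs hS hcont hmono hlam hα fun t ht r hr => ?_
  have ht' : t ∈ Set.Icc 0 σ := ⟨ht.1, ht.2.le⟩
  have hμ : 0 < G.robinEigenvalue VR n t := hlam0.trans_le (hmono h0mem ht' ht.1)
  have ht0 : 0 ≤ t := ht.1
  refine MetricGraph.eventually_robinEigenvalue_le hh hn hne ht.1 (by positivity) hr fun x hx => ?_
  exact MetricGraph.norm_sq_trace_le hh (D t) hμ ht.1 hs hS (fun w hw =>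
    (D t).le_of_sensitivityTerm_le hμ ht.1 hS (hSv t ht') (hsv t ht') ((hv t ht').2 w hw)) hx
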